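/- Let $A$ be a symmetric monoidal category that is locally presentable, and assume that for every object $X$ of $A$ the functors $X\otimes(-)$ and $(-)\otimes X$ preserve (small) directed colimits. Let $\mathbf{Mon}^{\mathrm{com}}_A$ be the category of commutative monoids in $A$ with respect to $\otimes$, in which finite coproducts are given by the tensor product and the unit object, and let $$\mathbf{Hopf}^{\mathrm{com}}_A := \mathrm{Grp}\bigl((\mathbf{Mon}^{\mathrm{com}}_A)^{\mathrm{op}}\bigr)^{\mathrm{op}}$$ be the category of commutative Hopf algebras in $A$, i.e. of internal cogroups in $\mathbf{Mon}^{\mathrm{com}}_A$. Then: 1. $\mathbf{Hopf}^{\mathrm{com}}_A$ is locally presentable; 2. $\mathbf{Hopf}^{\mathrm{com}}_A$ is pointed, i.e. it has an object that is both initial and terminal; 3. $\mathbf{Hopf}^{\mathrm{com}}_A$ is coprotomodular, i.e. $C:=(\mathbf{Hopf}^{\mathrm{com}}_A)^{\mathrm{op}}$ is protomodular: in $C$, pullbacks along retractions exist, and for every retraction $r\colon x\to y$ with a section $s$ ($rs=\mathrm{id}_y$), every morphism $f\colon b\to y$, and every pullback of $f$ along $r$, with projection $k\colon a\to x$, the pair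 $(s,k)$ is jointly extremal epimorphic, i.e. every monomorphism $m$ with codomain $x$ through which both $s$ and $k$ factor is an isomorphism. -/

import Mathlib

open CategoryTheory MonoidalCategory Limits Opposite
open scoped MonObj

universe v u

namespace CommMonCoproduct

section Objects

variable {A : Type u} [Category.{v} A] [MonoidalCategory A]

theorem isMonHom_one (X : A) [MonObj X] : IsMonHom η[X] :=
  ⟨by simp, by simp [← MonoidalCategory.unitors_equal]⟩

theorem inl_desc {X Y Z : A} [MonObj Y] [MonObj Z] (f : X ⟶ Z) (g : Y ⟶ Z) [IsMonHom g] :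
    ((ρ_ X).inv ≫ X ◁ η[Y]) ≫ (f ⊗ₘ g) ≫ μ[Z] = f := by
  have h : X ◁ η[Y] ≫ (f ⊗ₘ g) = f ▷ 𝟙_ A ≫ Z ◁ η[Z] := by
    rw [MonoidalCategory.tensorHom_def', ← MonoidalCategory.whiskerLeft_comp_assoc,
      IsMonHom.one_hom, whisker_exchange]
  rw [Category.assoc, reassoc_of% h]
  simp

theorem inr_desc {X Y Z : A} [MonObj X] [MonObj Z] (f : X ⟶ Z) (g : Y ⟶ Z) [IsMonHom f] :
    ((λ_ Y).inv ≫ η[X] ▷ Y) ≫ (f ⊗ₘ g) ≫ μ[Z] = g := by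
  have h : η[X] ▷ Y ≫ (f ⊗ₘ g) = 𝟙_ A ◁ g ≫ η[Z] ▷ Z := by
    rw [MonoidalCategory.tensorHom_def, ← MonoidalCategory.comp_whiskerRight_assoc,
      IsMonHom.one_hom, whisker_exchange]
  rw [Category.assoc, reassoc_of% h]
  simp

variable [BraidedCategory A]

theorem isMonHom_inl (X Y : A) [MonObj X] [MonObj Y] :
    IsMonHom ((ρ_ X).inv ≫ X ◁ η[Y]) := by
  have := isMonHom_one Y
  have : IsMonHom (ρ_ X).inv := inferInstance
  have : IsMonHom (X ◁ η[Y]) := inferInstance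
  exact instIsMonHomComp _ _

theorem isMonHom_inr (X Y : A) [MonObj X] [MonObj Y] :
    IsMonHom ((λ_ Y).inv ≫ η[X] ▷ Y) := by
  have := isMonHom_one X
  have : IsMonHom (λ_ Y).inv := inferInstance
  have : IsMonHom (η[X] ▷ Y) := inferInstance
  exact instIsMonHomComp _ _

theorem isMonHom_mul (Z : A) [MonObj Z] [IsCommMonObj Z] : IsMonHom μ[Z] where
  one_hom := by simp [MonObj.tensorObj.one_def, ← MonoidalCategory.unitors_equal]
  mul_hom := by simp [MonObj.tensorObj.mul_def]

theorem isMonHom_desc {X Y Z : A} [MonObj X] [MonObj Y] [MonObj Z] [IsCommMonObj Z]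
    (f : X ⟶ Z) (g : Y ⟶ Z) [IsMonHom f] [IsMonHom g] : IsMonHom ((f ⊗ₘ g) ≫ μ[Z]) := by
  have := isMonHom_mul Z
  exact instIsMonHomComp _ _

theorem inl_mul_inr (X Y : A) [MonObj X] [MonObj Y] :
    (((ρ_ X).inv ≫ X ◁ η[Y]) ⊗ₘ ((λ_ Y).inv ≫ η[X] ▷ Y)) ≫ μ[X ⊗ Y] = 𝟙 (X ⊗ Y) := by
  have h := tensorμ_natural (𝟙 X) η[Y] η[X] (𝟙 Y)
  simp only [id_tensorHom, tensorHom_id] at h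
  have h' : ((ρ_ X).inv ⊗ₘ (λ_ Y).inv) ≫ tensorμ X (𝟙_ A) (𝟙_ A) Y =
      (ρ_ X).inv ⊗ₘ (λ_ Y).inv := by
    simp only [tensorμ, braiding_tensorUnit_left]
    monoidal
  rw [MonObj.tensorObj.mul_def, ← tensorHom_comp_tensorHom, Category.assoc, reassoc_of% h,
    reassoc_of% h', tensorHom_comp_tensorHom, tensorHom_comp_tensorHom]
  simp

end Objects

variable {A : Type u} [Category.{v} A] [MonoidalCategory A] [SymmetricCategory A]

/-- The tensor product of two commutative monoids. -/
abbrev tensor (X Y : CommMon A) : CommMon A := ⟨X.X ⊗ Y.X⟩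

/-- The first coprojection `x ↦ x ⊗ 1`. -/
def inl (X Y : CommMon A) : X ⟶ tensor X Y :=
  CommMon.homMk (Mon.Hom.mk (M := X.toMon) (N := (tensor X Y).toMon)
    ((ρ_ X.X).inv ≫ X.X ◁ η[Y.X]) (isMonHom_hom := isMonHom_inl X.X Y.X))

/-- The second coprojection `y ↦ 1 ⊗ y`. -/
def inr (X Y : CommMon A) : Y ⟶ tensor X Y :=
  CommMon.homMk (Mon.Hom.mk (M := Y.toMon) (N := (tensor X Y).toMon)
    ((λ_ Y.X).inv ≫ η[X.X] ▷ Y.X) (isMonHom_hom := isMonHom_inr X.X Y.X))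

/-- The copairing `x ⊗ y ↦ f x * g y`. -/
def desc {X Y Z : CommMon A} (f : X ⟶ Z) (g : Y ⟶ Z) : tensor X Y ⟶ Z :=
  CommMon.homMk (Mon.Hom.mk (M := (tensor X Y).toMon) (N := Z.toMon)
    (((show X.X ⟶ Z.X from f.hom.hom) ⊗ₘ (show Y.X ⟶ Z.X from g.hom.hom)) ≫ μ[Z.X])
    (isMonHom_hom :=
      have : IsMonHom (show X.X ⟶ Z.X from f.hom.hom) := f.hom.isMonHom_hom
      have : IsMonHom (show Y.X ⟶ Z.X from g.hom.hom) := g.hom.isMonHom_hom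
      isMonHom_desc (show X.X ⟶ Z.X from f.hom.hom) (show Y.X ⟶ Z.X from g.hom.hom)))

theorem inl_comp_desc {X Y Z : CommMon A} (f : X ⟶ Z) (g : Y ⟶ Z) : inl X Y ≫ desc f g = f :=
  have : IsMonHom (show Y.X ⟶ Z.X from g.hom.hom) := g.hom.isMonHom_hom
  CommMon.hom_ext _ _ (inl_desc (X := X.X) (Y := Y.X) (Z := Z.X) f.hom.hom g.hom.hom)

theorem inr_comp_desc {X Y Z : CommMon A} (f : X ⟶ Z) (g : Y ⟶ Z) : inr X Y ≫ desc f g = g :=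
  have : IsMonHom (show X.X ⟶ Z.X from f.hom.hom) := f.hom.isMonHom_hom
  CommMon.hom_ext _ _ (inr_desc (X := X.X) (Y := Y.X) (Z := Z.X) f.hom.hom g.hom.hom)

theorem desc_inl_inr {X Y Z : CommMon A} (f : tensor X Y ⟶ Z) :
    desc (inl X Y ≫ f) (inr X Y ≫ f) = f := by
  apply CommMon.hom_ext
  have h := inl_mul_inr X.X Y.X
  have hf := f.hom.isMonHom_hom.mul_hom
  calc _ = ((((ρ_ X.X).inv ≫ X.X ◁ η[Y.X]) ≫ (show X.X ⊗ Y.X ⟶ Z.X from f.hom.hom)) ⊗ₘ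
        (((λ_ Y.X).inv ≫ η[X.X] ▷ Y.X) ≫ (show X.X ⊗ Y.X ⟶ Z.X from f.hom.hom))) ≫ μ[Z.X] := rfl
    _ = ((((ρ_ X.X).inv ≫ X.X ◁ η[Y.X]) ⊗ₘ ((λ_ Y.X).inv ≫ η[X.X] ▷ Y.X)) ≫ μ[X.X ⊗ Y.X]) ≫
        (show X.X ⊗ Y.X ⟶ Z.X from f.hom.hom) := by
      rw [← tensorHom_comp_tensorHom, Category.assoc, Category.assoc]
      exact congrArg _ hf.symm
    _ = _ := by rw [h]; exact Category.id_comp _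

theorem hom_ext {X Y Z : CommMon A} {f g : tensor X Y ⟶ Z} (h₁ : inl X Y ≫ f = inl X Y ≫ g)
    (h₂ : inr X Y ≫ f = inr X Y ≫ g) : f = g := by
  rw [← desc_inl_inr f, ← desc_inl_inr g, h₁, h₂]

/-- The tensor product, seen in the opposite category, as a binary product. -/
def limitCone (X Y : (CommMon A)ᵒᵖ) : LimitCone (pair X Y) where
  cone := BinaryFan.mk (P := op (tensor X.unop Y.unop)) (inl X.unop Y.unop).op
    (inr X.unop Y.unop).op
  isLimit := BinaryFan.isLimitMk (fun s => (desc s.fst.unop s.snd.unop).op)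
    (fun _ => Quiver.Hom.unop_inj (inl_comp_desc _ _))
    (fun _ => Quiver.Hom.unop_inj (inr_comp_desc _ _))
    (fun _ _ h₁ h₂ => Quiver.Hom.unop_inj (hom_ext
      ((congrArg Quiver.Hom.unop h₁).trans (inl_comp_desc _ _).symm)
      ((congrArg Quiver.Hom.unop h₂).trans (inr_comp_desc _ _).symm)))

/-- The tensor unit, seen in the opposite category, as a terminal object. -/
def terminalCone : LimitCone (Functor.empty.{0} (CommMon A)ᵒᵖ) where
  cone := asEmptyCone (op (CommMon.trivial A))
  isLimit := IsTerminal.ofUniqueHom (fun X => (default : CommMon.trivial A ⟶ X.unop).op)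
    (fun _ _ => Quiver.Hom.unop_inj (Subsingleton.elim _ _))

end CommMonCoproduct

/-- The opposite of the category of commutative monoids in a symmetric monoidal category has finite
products, given by the tensor product of the monoidal category: the product of `op X` and `op Y`
is `op (X ⊗ Y)` and the terminal object is `op (𝟙_ A)`. -/
instance cartesianMonoidalOp (A : Type u) [Category.{v} A] [MonoidalCategory A]
    [SymmetricCategory A] : CartesianMonoidalCategory (CommMon A)ᵒᵖ :=
  .ofChosenFiniteProducts CommMonCoproduct.terminalCone CommMonCoproduct.limitCone

/-- The category of commutative Hopf algebras in a symmetric monoidal category `A`: the category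
of internal cogroups in the category of commutative monoids in `A`, that is, the opposite of the
category of internal groups in `(CommMon A)ᵒᵖ`. -/
abbrev CommHopf (A : Type u) [Category.{v} A] [MonoidalCategory A] [SymmetricCategory A] :
    Type (max u v) :=
  (Grp (CommMon A)ᵒᵖ)ᵒᵖ

/-- A pair of morphisms with the same codomain is jointly extremal epimorphic if any monomorphism
through which both of them factor is an isomorphism. -/
def JointlyExtremalEpic {C : Type u} [Category.{v} C] {X Y Z : C} (f : X ⟶ Z) (g : Y ⟶ Z) : Prop :=
  ∀ ⦃W : C⦄ (m : W ⟶ Z) (f' : X ⟶ W) (g' : Y ⟶ W), Mono m → f' ≫ m = f → g' ≫ m = g → IsIso m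

/-- A category is protomodular if pullbacks along retractions exist and, for every retraction
`r : X ⟶ Y` with section `s` and every pullback `k : P ⟶ X` along `r` of a morphism `f : B ⟶ Y`,
the pair `(s, k)` is jointly extremal epimorphic. -/
structure IsProtomodular (C : Type u) [Category.{v} C] : Prop where
  hasPullback : ∀ ⦃X Y B : C⦄ (r : X ⟶ Y) (s : Y ⟶ X) (f : B ⟶ Y), s ≫ r = 𝟙 Y → HasPullback r f
  jointlyExtremalEpic : ∀ ⦃X Y B P : C⦄ (r : X ⟶ Y) (s : Y ⟶ X) (f : B ⟶ Y) (k : P ⟶ X)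
    (t : P ⟶ B), s ≫ r = 𝟙 Y → IsPullback k t r f → JointlyExtremalEpic s k

/-- A functor between categories with hom-sets in `Type v` preserves directed colimits if it
preserves the colimits of all diagrams indexed by a `v`-small nonempty directed poset. -/
def PreservesDirectedColimits {C D : Type u} [Category.{v} C] [Category.{v} D] (F : C ⥤ D) :
    Prop :=
  ∀ (J : Type v) [PartialOrder J] [IsDirectedOrder J] [Nonempty J], PreservesColimitsOfShape J F

-- Local presentability is proved for a general class of categories: objects `X` of a locally
-- presentable category with finitely many operations `F i X ⟶ G i X` (`Dialgebra`), subject to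
-- finitely many equations between natural maps `H e X ⟶ K e X`, all functors being finitary.
-- Commutative monoids are of this kind, with tensor powers as sources; cogroups in `M` are too,
-- with identity sources and copowers as targets.
--
-- The core is a Löwenheim–Skolem argument, recorded by `HasPresentableEnlargements`. Given a
-- `κ`-presentable `P` over a dialgebra `X`, the composites `F i P ⟶ F i X ⟶ G i X` factor through
-- `G i Q` for some `κ`-presentable `Q` between `P` and `X`. Iterating and passing to the sequential
-- colimit, which every `F i` preserves, gives a dialgebra over `X`; it is still `κ`-presentable
-- underneath because `κ` is uncountable. The same iteration forces the equations. The cardinal must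
-- be such that the functors `F i` and `H e` preserve `κ`-presentable objects; for tensor powers
-- this is `exists_isCardinalPresentable_tensor`, which rests on cardinals sharply larger than a
-- given one.
--
-- Consequently the objects with `κ`-presentable underlying object are `κ`-presentable, essentially
-- small in number, and form a strong generator, so such a category is locally presentable once it
-- is cocomplete. For commutative monoids, limits are inherited from `A`, and the enlargements
-- provide the solution sets needed to obtain colimits from the adjoint functor theorem. For
-- cogroups, colimits are limits of internal groups in the opposite category.
--
-- The trivial group gives the zero object. Protomodularity comes from the identity `x = (x · s(r
-- x)⁻¹) · s(r x)` in groups: the first factor is killed by `r`, hence comes from any pullback along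
-- `r`, and the second comes from the section. A monomorphism through which both maps factor is
-- therefore split epic on underlying objects, hence invertible.

universe w w' u' u''

attribute [local instance] Cardinal.fact_isRegular_aleph0

/-! ### Factoring and equalizing through presentable objects -/

section FactorThrough

variable {C : Type u} [Category.{v} C] (κ : Cardinal.{v}) [Fact κ.IsRegular]
  [IsCardinalLocallyPresentable C κ]

/-- In a locally `κ`-presentable category, a `κ`-small family of morphisms `A k ⟶ (G k).obj X` out
of `κ`-presentable objects factors through a `κ`-presentable object over `X`, which can be chosen
below a given `κ`-presentable object `P` over `X`. -/
theorem exists_presentable_factorization {K : Type w} (hK : HasCardinalLT K κ) {X P : C}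
    [hP : IsCardinalPresentable P κ] (p : P ⟶ X) (A : K → C) [∀ k, IsCardinalPresentable (A k) κ]
    (G : K → C ⥤ C) [∀ k, (G k).IsCardinalAccessible κ] (a : ∀ k, A k ⟶ (G k).obj X) :
    ∃ (Q : C) (_ : IsCardinalPresentable Q κ) (q : Q ⟶ X) (t : P ⟶ Q)
      (b : ∀ k, A k ⟶ (G k).obj Q), t ≫ q = p ∧ ∀ k, b k ≫ (G k).map q = a k := by
  obtain ⟨J, _, _, ⟨c⟩⟩ :=
    (isCardinalFilteredGenerator_isCardinalPresentable C κ).exists_colimitsOfShape X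
  have hc (k : K) := (G k).preservesColimitsOfShape_of_isCardinalAccessible κ J
  obtain ⟨j₀, t₀, ht₀⟩ := IsCardinalPresentable.exists_hom_of_isColimit κ c.isColimit p
  choose j b hb using fun k => IsCardinalPresentable.exists_hom_of_isColimit κ
    (isColimitOfPreserves (G k) c.isColimit) (a k)
  -- The additional index `none` stands for the stage at which `p` itself factors.
  have hK' : HasCardinalLT (Option K) κ :=
    (hasCardinalLT_option_iff _ _ (Cardinal.IsRegular.aleph0_le Fact.out)).2 hK
  let m := IsCardinalFiltered.max (fun k : Option K => k.elim j₀ j) hK'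
  have f (k : K) : j k ⟶ m := IsCardinalFiltered.toMax (fun k : Option K => k.elim j₀ j) hK' (some k)
  have f₀ : j₀ ⟶ m := IsCardinalFiltered.toMax (fun k : Option K => k.elim j₀ j) hK' none
  refine ⟨c.diag.obj m, c.prop_diag_obj m, c.ι.app m, t₀ ≫ c.diag.map f₀,
    fun k => b k ≫ (G k).map (c.diag.map (f k)), ?_, fun k => ?_⟩
  · simpa using ht₀
  · rw [Category.assoc, ← Functor.map_comp, c.w]
    exact hb k

/-- In a locally `κ`-presentable category, a `κ`-small family of pairs of morphisms
`A k ⟶ (G k).obj P` which get equal in `X` gets equal in a `κ`-presentable object over `X`. -/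
theorem exists_presentable_equalization {K : Type w} (hK : HasCardinalLT K κ) {X P : C}
    [hP : IsCardinalPresentable P κ] (p : P ⟶ X) (A : K → C) [∀ k, IsCardinalPresentable (A k) κ]
    (G : K → C ⥤ C) [∀ k, (G k).IsCardinalAccessible κ] (a b : ∀ k, A k ⟶ (G k).obj P)
    (hab : ∀ k, a k ≫ (G k).map p = b k ≫ (G k).map p) :
    ∃ (Q : C) (_ : IsCardinalPresentable Q κ) (q : Q ⟶ X) (t : P ⟶ Q),
      t ≫ q = p ∧ ∀ k, a k ≫ (G k).map t = b k ≫ (G k).map t := by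
  obtain ⟨J, _, _, ⟨c⟩⟩ :=
    (isCardinalFilteredGenerator_isCardinalPresentable C κ).exists_colimitsOfShape X
  have hc (k : K) := (G k).preservesColimitsOfShape_of_isCardinalAccessible κ J
  obtain ⟨j₀, t₀, ht₀⟩ := IsCardinalPresentable.exists_hom_of_isColimit κ c.isColimit p
  have ht₀ : t₀ ≫ c.ι.app j₀ = p := ht₀
  have h (k : K) : ∃ (j : J) (f : j₀ ⟶ j), (a k ≫ (G k).map t₀) ≫ (G k).map (c.diag.map f) =
      (b k ≫ (G k).map t₀) ≫ (G k).map (c.diag.map f) :=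
    IsCardinalPresentable.exists_eq_of_isColimit' κ (isColimitOfPreserves (G k) c.isColimit)
      (a k ≫ (G k).map t₀) (b k ≫ (G k).map t₀) (by
        simpa only [Category.assoc, Functor.mapCocone_ι_app, ← Functor.map_comp, ht₀] using hab k)
  choose j f hf using h
  obtain ⟨m, g, f₀, hg⟩ := IsCardinalFiltered.wideSpan f hK
  refine ⟨c.diag.obj m, c.prop_diag_obj m, c.ι.app m, t₀ ≫ c.diag.map f₀, ?_, fun k => ?_⟩
  · simpa using ht₀
  · have := hf k
    simp only [Category.assoc] at this
    simp only [← hg k, Functor.map_comp, reassoc_of% this]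

end FactorThrough

/-! ### Completeness of locally presentable categories -/

section Complete

/-- A locally presentable category is complete. -/
theorem CategoryTheory.IsLocallyPresentable.hasLimits (C : Type u) [Category.{v} C]
    [IsLocallyPresentable.{v} C] : HasLimitsOfSize.{v, v} C := by
  obtain ⟨κ, _, _⟩ := IsLocallyPresentable.exists_cardinal.{v} C
  let P := (isCardinalPresentable C κ)
  let e := equivSmallModel.{v} P.FullSubcategory
  let F : SmallModel.{v} P.FullSubcategory ⥤ C := e.inverse ⋙ P.ι
  -- Density of the `κ`-presentable objects makes the restricted Yoneda functor fully faithful, and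
  -- Kan extension provides its left adjoint; completeness then descends from presheaves.
  have : F.IsDense := inferInstance
  let R := Presheaf.restrictedULiftYoneda.{v} F
  have : Reflective R :=
    { L := uliftYoneda.{v}.leftKanExtension F
      adj := Presheaf.uliftYonedaAdjunction.{v} _ (uliftYoneda.leftKanExtensionUnit F) }
  exact hasLimits_of_reflective R

end Complete

/-! ### Limits of commutative monoids -/

section CommMonLimits

variable {A : Type u} [Category.{v} A] [MonoidalCategory A] [BraidedCategory A]

/-- Commutativity of a limit monoid can be tested along its projections, which are jointly monic and
land in commutative monoids. -/
theorem CategoryTheory.CommMon.braiding_mul_comp {M : Mon A} {N : CommMon A}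
    (f : M ⟶ (CommMon.forget₂Mon A).obj N) :
    ((β_ M.X M.X).hom ≫ μ[M.X]) ≫ f.hom = μ[M.X] ≫ f.hom := by
  have h := f.isMonHom_hom.mul_hom
  rw [Category.assoc, h, ← BraidedCategory.braiding_naturality_assoc]
  congr 1
  exact IsCommMonObj.mul_comm N.X

/-- Limits of commutative monoids are computed in monoids. -/
noncomputable instance CategoryTheory.CommMon.createsLimitsOfShape_forget₂Mon {J : Type*}
    [Category* J] [HasLimitsOfShape J A] : CreatesLimitsOfShape J (CommMon.forget₂Mon A) where
  CreatesLimit {F} := by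
    have : IsCommMonObj (limit (F ⋙ CommMon.forget₂Mon A)).X := ⟨by
      apply (isLimitOfPreserves (Mon.forget A) (limit.isLimit (F ⋙ CommMon.forget₂Mon A))).hom_ext
      intro j
      exact CommMon.braiding_mul_comp
        (N := F.obj j) ((limit.cone (F ⋙ CommMon.forget₂Mon A)).π.app j)⟩
    exact createsLimitOfFullyFaithfulOfIso ⟨(limit (F ⋙ CommMon.forget₂Mon A)).X⟩ (Iso.refl _)

instance CategoryTheory.CommMon.hasLimitsOfShape {J : Type*} [Category* J] [HasLimitsOfShape J A] :
    HasLimitsOfShape J (CommMon A) :=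
  hasLimitsOfShape_of_hasLimitsOfShape_createsLimitsOfShape (CommMon.forget₂Mon A)

end CommMonLimits

/-! ### Presentable enlargements and their consequences -/

section Enlargements

variable {C : Type u} [Category.{v} C] {E : Type u'} [Category.{v} E]

theorem isCardinalPresentable_colimit_of_fintype (κ : Cardinal.{v}) [Fact κ.IsRegular]
    {J : Type} [SmallCategory J] [FinCategory J] (F : J ⥤ C) [HasColimit F]
    (hF : ∀ j, IsCardinalPresentable (F.obj j) κ) : IsCardinalPresentable (colimit F) κ :=
  isCardinalPresentable_of_isColimit _ (colimit.isColimit F) κ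
    (hasCardinalLT_of_finite _ _ (Cardinal.IsRegular.aleph0_le Fact.out))

/-- A functor `U : E ⥤ C` has `κ`-presentable enlargements if, for every object `X` of `E`, any
`κ`-small family of objects over `X` with `κ`-presentable images by `U`, together with any
`κ`-presentable object of `C` between these images and `U.obj X`, is dominated by a single object
over `X` with a `κ`-presentable image. -/
def HasPresentableEnlargements (U : E ⥤ C) (κ : Cardinal.{v}) [Fact κ.IsRegular] : Prop :=
  ∀ ⦃X : E⦄ ⦃K : Type v⦄ (_ : HasCardinalLT K κ) (Y : K → E)
    (_ : ∀ k, IsCardinalPresentable (U.obj (Y k)) κ) (f : ∀ k, Y k ⟶ X) ⦃P : C⦄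
    (_ : IsCardinalPresentable P κ) (p : P ⟶ U.obj X) (g : ∀ k, U.obj (Y k) ⟶ P)
    (_ : ∀ k, g k ≫ p = U.map (f k)),
    ∃ (Z : E) (_ : IsCardinalPresentable (U.obj Z) κ) (h : Z ⟶ X) (q : P ⟶ U.obj Z)
      (t : ∀ k, Y k ⟶ Z), q ≫ U.map h = p ∧ (∀ k, t k ≫ h = f k) ∧ ∀ k, g k ≫ q = U.map (t k)

namespace HasPresentableEnlargements

variable {U : E ⥤ C} {κ : Cardinal.{v}} [Fact κ.IsRegular] (hU : HasPresentableEnlargements U κ)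

include hU

/-- The case of an empty family. -/
theorem exists_over {X : E} {P : C} [hP : IsCardinalPresentable P κ] (p : P ⟶ U.obj X) :
    ∃ (Z : E) (_ : IsCardinalPresentable (U.obj Z) κ) (h : Z ⟶ X) (q : P ⟶ U.obj Z),
      q ≫ U.map h = p := by
  obtain ⟨Z, hZ, h, q, _, hq, _⟩ := hU (X := X) (K := PEmpty)
    (hasCardinalLT_of_finite _ _ (Cardinal.IsRegular.aleph0_le Fact.out)) (fun k => k.elim)
    (fun k => k.elim) (fun k => k.elim) hP p (fun k => k.elim) (fun k => k.elim)
  exact ⟨Z, hZ, h, q, hq⟩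

/-- The case of a family with one member. -/
theorem exists_between {X Y : E} [hY : IsCardinalPresentable (U.obj Y) κ] (f : Y ⟶ X) {P : C}
    [hP : IsCardinalPresentable P κ] (p : P ⟶ U.obj X) (g : U.obj Y ⟶ P)
    (hg : g ≫ p = U.map f) :
    ∃ (Z : E) (_ : IsCardinalPresentable (U.obj Z) κ) (h : Z ⟶ X) (q : P ⟶ U.obj Z) (t : Y ⟶ Z),
      q ≫ U.map h = p ∧ t ≫ h = f ∧ g ≫ q = U.map t := by
  obtain ⟨Z, hZ, h, q, t, hq, ht, hgt⟩ := hU (X := X) (K := PUnit)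
    (hasCardinalLT_of_finite _ _ (Cardinal.IsRegular.aleph0_le Fact.out)) (fun _ => Y)
    (fun _ => hY) (fun _ => f) hP p (fun _ => g) (fun _ => hg)
  exact ⟨Z, hZ, h, q, t ⟨⟩, hq, ht ⟨⟩, hgt ⟨⟩⟩

/-- The objects with `κ`-presentable images detect isomorphisms among monomorphisms. -/
theorem isIso_of_mono [IsCardinalLocallyPresentable C κ] [U.ReflectsIsomorphisms] {Z X : E}
    (m : Z ⟶ X) [Mono m]
    (hm : ∀ (Y : E) (_ : IsCardinalPresentable (U.obj Y) κ) (f : Y ⟶ X), ∃ g, g ≫ m = f) :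
    IsIso m := by
  have hC := (isCardinalFilteredGenerator_isCardinalPresentable C κ).isStrongGenerator
  -- `U` is not assumed to preserve monomorphisms. Two maps `a`, `b` identified by `U.map m` are
  -- lifted to some `Y` over `Z`; their coequalizer maps to `U.obj X` and is enlarged to some `Z'`
  -- over `X`. Lifting `Z'` along `m` shows that they were already equal in `U.obj Z`.
  have : Mono (U.map m) := by
    rw [hC.isSeparating.mono_iff]
    intro P hP a b hab
    have : IsCardinalPresentable P κ := hP
    have hP' : IsCardinalPresentable (P ⨿ P) κ :=
      isCardinalPresentable_colimit_of_fintype κ _ (by rintro ⟨_ | _⟩ <;> exact hP)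
    obtain ⟨Y, hY, f, a', b', ha, hb⟩ : ∃ (Y : E) (_ : IsCardinalPresentable (U.obj Y) κ)
        (f : Y ⟶ Z) (a' b' : P ⟶ U.obj Y), a' ≫ U.map f = a ∧ b' ≫ U.map f = b := by
      obtain ⟨Y, hY, f, q, hq⟩ := hU.exists_over (coprod.desc a b)
      refine ⟨Y, hY, f, coprod.inl ≫ q, coprod.inr ≫ q, ?_, ?_⟩
      · rw [Category.assoc, hq]
        exact coprod.inl_desc a b
      · rw [Category.assoc, hq]
        exact coprod.inr_desc a b
    have hQ : IsCardinalPresentable (coequalizer a' b') κ :=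
      isCardinalPresentable_colimit_of_fintype κ _ (by rintro (_ | _) <;> assumption)
    obtain ⟨Z', hZ', f', q', t, -, ht, hqt⟩ := hU.exists_between (f ≫ m)
      (coequalizer.desc (U.map (f ≫ m)) (by rw [U.map_comp, reassoc_of% ha, reassoc_of% hb, hab]))
      (coequalizer.π a' b') (by simp)
    obtain ⟨g, rfl⟩ := hm Z' hZ' f'
    have hg : t ≫ g = f := by rw [← cancel_mono m, Category.assoc, ht]
    have h := coequalizer.condition_assoc a' b' q'
    rw [hqt] at h
    rw [← ha, ← hb, ← hg, U.map_comp, reassoc_of% h]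
  have : IsIso (U.map m) := hC.isIso_of_mono _ fun P hP p => by
    have : IsCardinalPresentable P κ := hP
    obtain ⟨Y, hY, f, q, hq⟩ := hU.exists_over p
    obtain ⟨g, rfl⟩ := hm Y hY f
    exact ⟨q ≫ U.map g, by simpa using hq⟩
  exact isIso_of_reflects_iso m U

/-- A cocomplete category is locally presentable as soon as it is equipped with a conservative functor
to a locally presentable category which has presentable enlargements. -/
theorem isCardinalLocallyPresentable [IsCardinalLocallyPresentable C κ] [U.ReflectsIsomorphisms]
    [U.Faithful] [HasColimitsOfSize.{v, v} E]
    [ObjectProperty.EssentiallySmall.{v} ((isCardinalPresentable C κ).inverseImage U)]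
    (hE : (isCardinalPresentable C κ).inverseImage U ≤ isCardinalPresentable E κ) :
    IsCardinalLocallyPresentable E κ := by
  rw [IsCardinalLocallyPresentable.iff_exists_isStrongGenerator]
  obtain ⟨Q, hQ, hQ₁, hQ₂⟩ := ObjectProperty.EssentiallySmall.exists_small_le.{v}
    ((isCardinalPresentable C κ).inverseImage U)
  refine ⟨Q, hQ, ?_, hQ₁.trans hE⟩
  have hC := (isCardinalFilteredGenerator_isCardinalPresentable C κ).isStrongGenerator
  rw [ObjectProperty.isStrongGenerator_iff]
  refine ⟨fun X Y f g hfg => ?_, fun X Y m _ hm => hU.isIso_of_mono m fun Z hZ f => ?_⟩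
  · refine U.map_injective (hC.isSeparating _ _ fun P hP p => ?_)
    have : IsCardinalPresentable P κ := hP
    obtain ⟨Z, hZ, h, q, rfl⟩ := hU.exists_over p
    obtain ⟨Z', hZ', ⟨e⟩⟩ := hQ₂ Z hZ
    have := hfg Z' hZ' (e.inv ≫ h)
    simp only [Category.assoc, Iso.cancel_iso_inv_left] at this
    rw [Category.assoc, Category.assoc, ← U.map_comp, ← U.map_comp, this]
  · obtain ⟨Z', hZ', ⟨e⟩⟩ := hQ₂ Z hZ
    obtain ⟨g, hg⟩ := hm Z' hZ' (e.inv ≫ f)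
    dsimp only at hg
    exact ⟨e.hom ≫ g, by rw [Category.assoc, hg, e.hom_inv_id_assoc]⟩

end HasPresentableEnlargements

/-- A complete category is cocomplete as soon as it is equipped with a faithful functor to a
cocomplete category whose objects are presentable, which has `κ`-presentable enlargements for
arbitrarily large `κ`. -/
theorem hasColimitsOfSize_of_hasPresentableEnlargements (U : E ⥤ C) [U.Faithful]
    [HasColimitsOfSize.{v, v} C] [HasLimitsOfSize.{v, v} E] (hC : ∀ X : C, IsPresentable.{v} X)
    (hU : ∀ κ₀ : Cardinal.{v}, ∃ (κ : Cardinal.{v}) (_ : Fact κ.IsRegular), κ₀ ≤ κ ∧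
      HasPresentableEnlargements U κ ∧
      ObjectProperty.EssentiallySmall.{v} ((isCardinalPresentable C κ).inverseImage U)) :
    HasColimitsOfSize.{v, v} E := by
  -- Colimits of shape `J` amount to a left adjoint of the diagonal functor, which preserves limits;
  -- only the solution set condition remains.
  refine ⟨fun J _ => hasColimitsOfShape_iff_isRightAdjoint_const.2
    (isRightAdjoint_of_preservesLimits_of_solutionSetCondition _ fun D => ?_)⟩
  choose κ' hκ' hκ'' using fun j => (hC (U.obj (D.obj j))).exists_cardinal
  -- This `κ` exceeds the number of arrows of `J` and bounds the presentability ranks of all `U.obj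
  -- (D.obj j)`, so that the colimit of `D ⋙ U` is `κ`-presentable. Enlarging it shows that every
  -- cocone factors through one whose vertex has a `κ`-presentable image.
  obtain ⟨κ, _, hκ, hU, hs⟩ := hU (max (Order.succ (Cardinal.mk (Arrow J))) (⨆ j, κ' j))
  obtain ⟨Q, hQ, hQ₁, hQ₂⟩ := ObjectProperty.EssentiallySmall.exists_small_le.{v}
    ((isCardinalPresentable C κ).inverseImage U)
  have hJ : HasCardinalLT (Arrow J) κ := by
    rw [hasCardinalLT_iff_cardinal_mk_lt]
    exact (Order.lt_succ _).trans_le ((le_max_left _ _).trans hκ)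
  have hD (j : J) : IsCardinalPresentable (U.obj (D.obj j)) κ := by
    have := hκ' j
    have : IsCardinalPresentable (U.obj (D.obj j)) (κ' j) := hκ'' j
    exact isCardinalPresentable_of_le _
      ((le_ciSup (Cardinal.bddAbove_of_small) j).trans ((le_max_right _ _).trans hκ))
  refine ⟨Σ Y : Shrink.{v} (Subtype Q), D ⟶ (Functor.const J).obj ((equivShrink _).symm Y).1,
    fun i => ((equivShrink _).symm i.1).1, fun i => i.2, fun X c => ?_⟩
  have hD' (j : J) : IsCardinalPresentable ((D ⋙ U).obj j) κ := hD j
  have hP : IsCardinalPresentable (colimit (D ⋙ U)) κ :=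
    isCardinalPresentable_of_isColimit _ (colimit.isColimit (D ⋙ U)) κ hJ
  obtain ⟨Z, hZ, h, q, t, -, ht, hqt⟩ := hU (X := X) (hasCardinalLT_of_hasCardinalLT_arrow hJ)
    D.obj hD c.app hP (colimit.desc (D ⋙ U) (U.mapCocone (Cocone.mk X c)))
    (colimit.ι (D ⋙ U)) (fun j => by simp)
  obtain ⟨Z', hZ', ⟨e⟩⟩ := hQ₂ Z hZ
  let Y : Shrink.{v} (Subtype Q) := equivShrink _ ⟨Z', hZ'⟩
  let e' : Z ≅ ((equivShrink _).symm Y).1 := e ≪≫ eqToIso (by simp [Y])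
  refine ⟨⟨Y, { app j := t j ≫ e'.hom, naturality {i j} f := ?_ }⟩, e'.inv ≫ h, ?_⟩
  · have : D.map f ≫ t j = t i := U.map_injective (by
      rw [U.map_comp, ← hqt, ← hqt]
      exact colimit.w_assoc (D ⋙ U) f q)
    simp [reassoc_of% this]
  · ext j
    simp [ht]

end Enlargements

/-! ### Dialgebras: colimits and presentability -/

section Dialgebras

variable {C : Type u} [Category.{v} C] {I : Type w}

/-- A dialgebra for two families of endofunctors `F` and `G` is an object `X` equipped with
morphisms `(F i).obj X ⟶ (G i).obj X`. -/
structure Dialgebra (F G : I → C ⥤ C) where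
  /-- The underlying object. -/
  X : C
  /-- The structure morphisms. -/
  str (i : I) : (F i).obj X ⟶ (G i).obj X

namespace Dialgebra

variable {F G : I → C ⥤ C}

/-- Morphisms of dialgebras commute with the structure morphisms. -/
@[ext]
structure Hom (X Y : Dialgebra F G) where
  /-- The underlying morphism. -/
  hom : X.X ⟶ Y.X
  comm (i : I) : X.str i ≫ (G i).map hom = (F i).map hom ≫ Y.str i

instance : Category (Dialgebra F G) where
  Hom := Hom
  id X := ⟨𝟙 X.X, fun i => by simp⟩
  comp f g := ⟨f.hom ≫ g.hom, fun i => by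
    rw [Functor.map_comp, ← Category.assoc, f.comm, Category.assoc, g.comm, Functor.map_comp,
      Category.assoc]⟩

@[ext]
theorem hom_ext {X Y : Dialgebra F G} {f g : X ⟶ Y} (h : f.hom = g.hom) : f = g := Hom.ext h

@[simp]
theorem id_hom (X : Dialgebra F G) : Hom.hom (𝟙 X) = 𝟙 X.X := rfl

@[simp]
theorem comp_hom {X Y Z : Dialgebra F G} (f : X ⟶ Y) (g : Y ⟶ Z) :
    (f ≫ g).hom = f.hom ≫ g.hom := rfl

variable (F G) in
/-- The underlying object of a dialgebra. -/
@[simps]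
def forget : Dialgebra F G ⥤ C where
  obj X := X.X
  map f := f.hom

instance : (forget F G).Faithful where
  map_injective h := hom_ext h

/-- An isomorphism of dialgebras from an isomorphism of the underlying objects. -/
@[simps]
def isoMk {X Y : Dialgebra F G} (e : X.X ≅ Y.X)
    (h : ∀ i, X.str i ≫ (G i).map e.hom = (F i).map e.hom ≫ Y.str i) : X ≅ Y where
  hom := ⟨e.hom, h⟩
  inv := ⟨e.inv, fun i => by
    rw [← cancel_epi ((F i).map e.hom), ← Category.assoc, ← h i]
    simp [← Functor.map_comp, ← Functor.map_comp_assoc]⟩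

instance : (forget F G).ReflectsIsomorphisms where
  reflects {X Y} f _ := by
    have : IsIso f.hom := inferInstanceAs (IsIso ((forget F G).map f))
    exact (isoMk (asIso f.hom) f.comm).isIso_hom

theorem map_comp_str {X Z : Dialgebra F G} {i : I} {Y : C} {x : X.X ⟶ Y} {y : Y ⟶ Z.X}
    {s : (F i).obj Y ⟶ (G i).obj Y} (hs : (F i).map x ≫ s = X.str i ≫ (G i).map x) (f : X ⟶ Z)
    (hf : x ≫ y = f.hom) :
    (F i).map x ≫ s ≫ (G i).map y = (F i).map x ≫ (F i).map y ≫ Z.str i := by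
  rw [reassoc_of% hs, ← Functor.map_comp, ← Functor.map_comp_assoc, hf, f.comm]

theorem str_comp_map_of_comp_eq {X Y Z : Dialgebra F G} (i : I) {x : X.X ⟶ Y.X} (y : Y ⟶ Z)
    (f : X ⟶ Z) (hf : x ≫ y.hom = f.hom) :
    (X.str i ≫ (G i).map x) ≫ (G i).map y.hom = ((F i).map x ≫ Y.str i) ≫ (G i).map y.hom := by
  rw [Category.assoc, ← Functor.map_comp, hf, f.comm, ← hf, Category.assoc, y.comm,
    Functor.map_comp, Category.assoc]

theorem str_comp_map_of_equalizes {X Y Z W : Dialgebra F G} (i : I) {x : X.X ⟶ Y.X} (y : Y ⟶ Z)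
    (z : Z ⟶ W)
    (h : (X.str i ≫ (G i).map x) ≫ (G i).map y.hom =
      ((F i).map x ≫ Y.str i) ≫ (G i).map y.hom) :
    X.str i ≫ (G i).map (x ≫ (y ≫ z).hom) = (F i).map (x ≫ (y ≫ z).hom) ≫ W.str i := by
  rw [Functor.map_comp, Functor.map_comp, Category.assoc, ← (y ≫ z).comm, comp_hom,
    Functor.map_comp, reassoc_of% h]

section Colimits

variable {J : Type*} [Category* J] (D : J ⥤ Dialgebra F G) (c : Cocone (D ⋙ forget F G))
  (hc : IsColimit c) [∀ i, PreservesColimit (D ⋙ forget F G) (F i)]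

/-- The natural transformation given by the structure morphisms. -/
@[simps]
def strNatTrans (i : I) : forget F G ⋙ F i ⟶ forget F G ⋙ G i where
  app X := X.str i
  naturality _ _ f := (f.comm i).symm

/-- The structure morphisms on a colimit of underlying objects. -/
noncomputable def colimitStr (i : I) : (F i).obj c.pt ⟶ (G i).obj c.pt :=
  (isColimitOfPreserves (F i) hc).desc (Cocone.mk ((G i).obj c.pt)
    (Functor.whiskerLeft D (strNatTrans i) ≫ Cocone.ι ((G i).mapCocone c)))

theorem map_app_colimitStr (i : I) (j : J) :
    (F i).map (c.ι.app j) ≫ colimitStr D c hc i = (D.obj j).str i ≫ (G i).map (c.ι.app j) :=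
  (isColimitOfPreserves (F i) hc).fac _ j

/-- The dialgebra structure on a colimit of underlying objects. -/
noncomputable def colimitCocone : Cocone D :=
  Cocone.mk ⟨c.pt, colimitStr D c hc⟩
    { app j := ⟨c.ι.app j, fun i => (map_app_colimitStr D c hc i j).symm⟩
      naturality _ _ f := hom_ext (c.ι.naturality f) }

/-- The dialgebra structure on a colimit of underlying objects gives a colimit of dialgebras. -/
noncomputable def isColimitColimitCocone : IsColimit (colimitCocone D c hc) where
  desc s := ⟨hc.desc ((forget F G).mapCocone s), fun i => by
    apply (isColimitOfPreserves (F i) hc).hom_ext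
    intro j
    exact map_comp_str (map_app_colimitStr D c hc i j) (s.ι.app j)
      (hc.fac ((forget F G).mapCocone s) j)⟩
  fac s j := hom_ext (hc.fac ((forget F G).mapCocone s) j)
  uniq s m hm := hom_ext (hc.uniq ((forget F G).mapCocone s) m.hom
    fun j => congrArg Hom.hom (hm j))

noncomputable instance : CreatesColimit D (forget F G) :=
  createsColimitOfReflectsIso fun c hc =>
    { liftedCocone := colimitCocone D c hc
      validLift := Cocone.ext (Iso.refl _) fun _ => Category.comp_id _
      makesColimit := isColimitColimitCocone D c hc }

end Colimits

section Presentable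

variable (κ : Cardinal.{v}) [Fact κ.IsRegular]

/-- A dialgebra with a `κ`-presentable underlying object is `κ`-presentable. -/
theorem isCardinalPresentable [HasColimitsOfSize.{v, v} C] (hI : HasCardinalLT I κ)
    [∀ i, (F i).IsCardinalAccessible κ] [∀ i, (G i).IsCardinalAccessible κ] (X : Dialgebra F G)
    [IsCardinalPresentable X.X κ] [∀ i, IsCardinalPresentable ((F i).obj X.X) κ] :
    IsCardinalPresentable X κ where
  preservesColimitOfShape J _ _ := ⟨fun {D} => ⟨fun {c} hc => ⟨by
    have := isFiltered_of_isCardinalFiltered J κ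
    have (i : I) := (F i).preservesColimitsOfShape_of_isCardinalAccessible κ J
    have (i : I) := (G i).preservesColimitsOfShape_of_isCardinalAccessible κ J
    have hc' := isColimitOfPreserves (forget F G) hc
    refine Types.FilteredColimit.isColimitOf' _ _ (fun (f : X ⟶ c.pt) => ?_)
      (fun j (f g : X ⟶ D.obj j) hfg => ?_)
    · obtain ⟨j, f', hf'⟩ : ∃ (j : J) (f' : X.X ⟶ (D.obj j).X), f' ≫ (c.ι.app j).hom = f.hom :=
        IsCardinalPresentable.exists_hom_of_isColimit κ hc' f.hom
      -- The factorization `f'` need not respect the operations. The two composites out of `(F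
      -- i).obj X.X` agree in the colimit, hence at a later stage, and one stage serves all `i`
      -- because there are fewer than `κ` of them.
      have h (i : I) : ∃ (k : J) (a : j ⟶ k),
          (X.str i ≫ (G i).map f') ≫ (G i).map (D.map a).hom =
            ((F i).map f' ≫ (D.obj j).str i) ≫ (G i).map (D.map a).hom :=
        IsCardinalPresentable.exists_eq_of_isColimit' κ (isColimitOfPreserves (G i) hc')
          (X.str i ≫ (G i).map f') ((F i).map f' ≫ (D.obj j).str i)
          (str_comp_map_of_comp_eq i (c.ι.app j) f hf')
      choose k a ha using h
      obtain ⟨l, b, a', hb⟩ := IsCardinalFiltered.wideSpan a hI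
      refine ⟨l, ⟨f' ≫ (D.map a').hom, fun i => ?_⟩, hom_ext ?_⟩
      · rw [← hb i, D.map_comp]
        exact str_comp_map_of_equalizes i _ _ (ha i)
      · refine hf'.symm.trans ?_
        rw [← c.w a']
        exact (Category.assoc _ _ _).symm
    · obtain ⟨k, a, h⟩ := IsCardinalPresentable.exists_eq_of_isColimit' κ hc' f.hom g.hom
        (congrArg Hom.hom hfg)
      exact ⟨k, a, hom_ext h⟩⟩⟩⟩

/-- There is an essentially small family of dialgebras whose underlying objects belong to a given
essentially small family. -/
theorem essentiallySmall_inverseImage_forget [Small.{v} I] (P : ObjectProperty C)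
    [hP : ObjectProperty.EssentiallySmall.{v} P] :
    ObjectProperty.EssentiallySmall.{v} (P.inverseImage (forget F G)) := by
  obtain ⟨Q, _, hQ⟩ := ObjectProperty.EssentiallySmall.exists_small_le' P
  let Y (a : Σ P : Subtype Q, ∀ i, (F i).obj P.1 ⟶ (G i).obj P.1) : Dialgebra F G := ⟨a.1.1, a.2⟩
  refine ⟨.ofObj Y, inferInstance, fun X hX => ?_⟩
  obtain ⟨Z, hZ, ⟨e⟩⟩ := hQ _ hX
  let a : Σ P : Subtype Q, ∀ i, (F i).obj P.1 ⟶ (G i).obj P.1 :=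
    ⟨⟨Z, hZ⟩, fun i => (F i).map e.inv ≫ X.str i ≫ (G i).map e.hom⟩
  exact ⟨Y a, ⟨a⟩,
    ⟨isoMk (X := X) (Y := Y a) e fun i => (Iso.map_hom_inv_id_assoc e (F i) _).symm⟩⟩

end Presentable

end Dialgebra

end Dialgebras

/-! ### Sequential colimits -/

section Sequences

variable {C : Type u} [Category.{v} C]

theorem preservesColimitsOfShape_nat_of_isFinitelyAccessible (F : C ⥤ C)
    [Functor.IsFinitelyAccessible.{v} F] : PreservesColimitsOfShape ℕ F := by
  have : IsCardinalFiltered ℕ Cardinal.aleph0.{v} :=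
    (isCardinalFiltered_aleph0_iff _).2 inferInstance
  have : EssentiallySmall.{v} ℕ := essentiallySmall_of_small_of_locallySmall _
  exact F.preservesColimitsOfShape_of_isCardinalAccessible_of_essentiallySmall
    Cardinal.aleph0.{v} ℕ

theorem hasCardinalLT_arrow_nat {κ : Cardinal.{v}} (hκ : Cardinal.aleph0 < κ) :
    HasCardinalLT (Arrow ℕ) κ := by
  have : Countable (Arrow ℕ) :=
    Function.Injective.countable (f := fun a : Arrow ℕ => (a.left, a.right)) fun a b h => by
      obtain ⟨a₁, a₂, f⟩ := a
      obtain ⟨b₁, b₂, g⟩ := b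
      obtain ⟨rfl, rfl⟩ := Prod.ext_iff.1 h
      exact congrArg _ (Subsingleton.elim (α := a₁ ⟶ a₂) f g)
  refine lt_of_le_of_lt (b := Cardinal.aleph0) ?_ (by simpa using hκ)
  simp

theorem hasColimitsOfShape_nat [HasColimitsOfSize.{v, v} C] : HasColimitsOfShape ℕ C := by
  have : EssentiallySmall.{v} ℕ := essentiallySmall_of_small_of_locallySmall _
  exact hasColimitsOfShape_of_equivalence (equivSmallModel.{v} ℕ).symm

theorem isCardinalPresentable_colimit_nat (κ : Cardinal.{v}) [Fact κ.IsRegular]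
    (hκ : Cardinal.aleph0 < κ) (D : ℕ ⥤ C) (hD : ∀ n, IsCardinalPresentable (D.obj n) κ)
    (c : Cocone D) (hc : IsColimit c) : IsCardinalPresentable c.pt κ := by
  exact isCardinalPresentable_of_isColimit c hc κ (hasCardinalLT_arrow_nat hκ)

/-- A cocone over a functor `ℕ ⥤ C` from the compatibility with successive transition morphisms. -/
def coconeNat {D : ℕ ⥤ C} (Y : C) (f : ∀ n, D.obj n ⟶ Y)
    (hf : ∀ n, D.map (homOfLE (n.le_add_right 1)) ≫ f (n + 1) = f n) : Cocone D :=
  Cocone.mk Y (NatTrans.ofSequence f fun n => (hf n).trans (Category.comp_id _).symm)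

end Sequences

/-! ### Presentable enlargements of dialgebras -/

section Inserter

variable {C : Type u} [Category.{v} C] {I : Type w} {F G : I → C ⥤ C} (κ : Cardinal.{v})
  [Fact κ.IsRegular]

namespace Dialgebra

/-- A partially defined dialgebra structure on a `κ`-presentable object over the underlying object
of a dialgebra `X`. -/
structure Approximation (X : Dialgebra F G) where
  /-- The source of the structure morphisms. -/
  P : C
  /-- The target of the structure morphisms. -/
  Q : C
  presentable_P : IsCardinalPresentable P κ
  presentable_Q : IsCardinalPresentable Q κ
  /-- The projection. -/
  p : P ⟶ X.X
  /-- The projection. -/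
  q : Q ⟶ X.X
  /-- The transition morphism. -/
  t : P ⟶ Q
  t_comp_q : t ≫ q = p
  /-- The structure morphisms. -/
  s (i : I) : (F i).obj P ⟶ (G i).obj Q
  s_comp_map (i : I) : s i ≫ (G i).map q = (F i).map p ≫ X.str i

variable [IsCardinalLocallyPresentable C κ] [∀ i, (G i).IsCardinalAccessible κ]
  (hF : ∀ (i : I) (X : C), IsCardinalPresentable X κ → IsCardinalPresentable ((F i).obj X) κ)
  (hI : HasCardinalLT I κ)

include hF hI in
-- First the operations of `X` restricted to `P` are factored through a presentable object, then
-- that object is enlarged to realize a small family of equations already valid in `X`. The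
-- equations serve to make successive approximations, or given dialgebras over `X`, compatible with
-- the new operations.
theorem exists_approximation (X : Dialgebra F G) {P : C} (hP : IsCardinalPresentable P κ)
    (p : P ⟶ X.X) {K : Type w'} (hK : HasCardinalLT K κ) (i : K → I) (A : K → C)
    (hA : ∀ k, IsCardinalPresentable (A k) κ) (a : ∀ k, A k ⟶ (F (i k)).obj P)
    (b : ∀ k, A k ⟶ (G (i k)).obj P)
    (hab : ∀ k, a k ≫ (F (i k)).map p ≫ X.str (i k) = b k ≫ (G (i k)).map p) :
    ∃ (Q : C) (_ : IsCardinalPresentable Q κ) (q : Q ⟶ X.X) (t : P ⟶ Q)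
      (s : ∀ i, (F i).obj P ⟶ (G i).obj Q), t ≫ q = p ∧
      (∀ i, s i ≫ (G i).map q = (F i).map p ≫ X.str i) ∧
      ∀ k, a k ≫ s (i k) = b k ≫ (G (i k)).map t := by
  have (i : I) := hF i P hP
  obtain ⟨Q₁, hQ₁, q₁, t₁, s₁, ht₁, hs₁⟩ := exists_presentable_factorization κ hI p
    (fun i => (F i).obj P) G (fun i => (F i).map p ≫ X.str i)
  obtain ⟨Q, hQ, q, t, ht, hs⟩ := exists_presentable_equalization κ hK q₁ A (fun k => G (i k))
    (fun k => a k ≫ s₁ (i k)) (fun k => b k ≫ (G (i k)).map t₁) fun k => by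
      rw [Category.assoc, hs₁, hab, Category.assoc, ← Functor.map_comp, ht₁]
  refine ⟨Q, hQ, q, t₁ ≫ t, fun i => s₁ i ≫ (G i).map t, by rw [Category.assoc, ht, ht₁],
    fun i => by rw [Category.assoc, ← Functor.map_comp, ht, hs₁], fun k => ?_⟩
  have := hs k
  rwa [Category.assoc, Category.assoc, ← Functor.map_comp] at this

namespace Approximation

variable {κ}

include hF hI in
-- The last condition says that the new partial operations extend the old ones, so that they glue in
-- the sequential colimit.
theorem exists_next {X : Dialgebra F G} (S : Approximation κ X) :
    ∃ T : Σ (R : C) (_ : R ⟶ X.X) (_ : S.Q ⟶ R), ∀ i, (F i).obj S.Q ⟶ (G i).obj R,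
      IsCardinalPresentable T.1 κ ∧ T.2.2.1 ≫ T.2.1 = S.q ∧
      (∀ i, T.2.2.2 i ≫ (G i).map T.2.1 = (F i).map S.q ≫ X.str i) ∧
      ∀ i, (F i).map S.t ≫ T.2.2.2 i = S.s i ≫ (G i).map T.2.2.1 := by
  obtain ⟨R, hR, r, t, s, h₁, h₂, h₃⟩ := exists_approximation κ hF hI X S.presentable_Q S.q hI id
    (fun i => (F i).obj S.P) (fun i => hF i _ S.presentable_P) (fun i => (F i).map S.t)
    (fun i => S.s i) (fun i => by
      change (F i).map S.t ≫ (F i).map S.q ≫ X.str i = S.s i ≫ (G i).map S.q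
      rw [S.s_comp_map, ← S.t_comp_q, Functor.map_comp, Category.assoc])
  exact ⟨⟨R, r, t, s⟩, hR, h₁, h₂, h₃⟩

/-- An approximation which extends a given one. -/
noncomputable def next {X : Dialgebra F G} (S : Approximation κ X) : Approximation κ X :=
  have h := (exists_next hF hI S).choose_spec
  { P := S.Q
    Q := (exists_next hF hI S).choose.1
    presentable_P := S.presentable_Q
    presentable_Q := h.1
    p := S.q
    q := (exists_next hF hI S).choose.2.1
    t := (exists_next hF hI S).choose.2.2.1
    t_comp_q := h.2.1
    s := (exists_next hF hI S).choose.2.2.2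
    s_comp_map := h.2.2.1 }

variable {X : Dialgebra F G} (S : Approximation κ X)

/-- The sequence of iterated extensions of an approximation. -/
noncomputable def iterate : ℕ → Approximation κ X
  | 0 => S
  | n + 1 => (iterate n).next hF hI

/-- The transition morphisms in the sequence of approximations. -/
noncomputable def transition (n : ℕ) :
    (S.iterate hF hI n).P ⟶ (S.iterate hF hI (n + 1)).P :=
  (S.iterate hF hI n).t

/-- The partial structure morphisms in the sequence of approximations. -/
noncomputable def partialStr (n : ℕ) (i : I) :
    (F i).obj (S.iterate hF hI n).P ⟶ (G i).obj (S.iterate hF hI (n + 1)).P :=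
  (S.iterate hF hI n).s i

theorem transition_comp_p (n : ℕ) :
    S.transition hF hI n ≫ (S.iterate hF hI (n + 1)).p = (S.iterate hF hI n).p :=
  (S.iterate hF hI n).t_comp_q

theorem partialStr_comp_map (n : ℕ) (i : I) :
    S.partialStr hF hI n i ≫ (G i).map (S.iterate hF hI (n + 1)).p =
      (F i).map (S.iterate hF hI n).p ≫ X.str i :=
  (S.iterate hF hI n).s_comp_map i

theorem map_transition_comp_partialStr (n : ℕ) (i : I) :
    (F i).map (S.transition hF hI n) ≫ S.partialStr hF hI (n + 1) i =
      S.partialStr hF hI n i ≫ (G i).map (S.transition hF hI (n + 1)) :=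
  ((S.iterate hF hI n).exists_next hF hI).choose_spec.2.2.2 i

/-- The sequential diagram of approximations. -/
noncomputable def diagram : ℕ ⥤ C := Functor.ofSequence (S.transition hF hI)

include hF hI in
/-- An approximation extends to a dialgebra over `X`. -/
theorem exists_dialgebra (hκ : Cardinal.aleph0 < κ) [∀ i, Functor.IsFinitelyAccessible.{v} (F i)] :
    ∃ (Z : Dialgebra F G) (_ : IsCardinalPresentable Z.X κ) (h : Z ⟶ X) (z : S.Q ⟶ Z.X),
      z ≫ h.hom = S.q ∧ ∀ i, (F i).map (S.t ≫ z) ≫ Z.str i = S.s i ≫ (G i).map z := by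
  have := hasColimitsOfShape_nat (C := C)
  have (i : I) := preservesColimitsOfShape_nat_of_isFinitelyAccessible (F i)
  let D := S.diagram hF hI
  let c := colimit.cocone D
  let hc : IsColimit c := colimit.isColimit D
  let z (n : ℕ) : (S.iterate hF hI n).P ⟶ colimit D := colimit.ι D n
  have hD (n : ℕ) : D.map (homOfLE (n.le_add_right 1)) = S.transition hF hI n :=
    Functor.ofSequence_map_homOfLE_succ _ n
  have hz (n : ℕ) : S.transition hF hI n ≫ z (n + 1) = z n := by
    rw [← hD n]
    exact colimit.w D (homOfLE (n.le_add_right 1))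
  have hs' (n : ℕ) (i : I) : (F i).map (S.transition hF hI n) ≫
      S.partialStr hF hI (n + 1) i ≫ (G i).map (z (n + 2)) =
      S.partialStr hF hI n i ≫ (G i).map (z (n + 1)) := by
    have := S.map_transition_comp_partialStr hF hI n i
    rw [reassoc_of% this, ← Functor.map_comp, hz]
  -- Each partial operation raises the stage by one, a shift absorbed in the colimit. Only `F i` has
  -- to preserve this colimit.
  let s (i : I) : (F i).obj (colimit D) ⟶ (G i).obj (colimit D) :=
    (isColimitOfPreserves (F i) hc).desc (coconeNat _
      (fun n => S.partialStr hF hI n i ≫ (G i).map (z (n + 1))) (fun n => by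
        rw [Functor.comp_map, hD]
        exact hs' n i))
  have hs (n : ℕ) (i : I) : (F i).map (z n) ≫ s i =
      S.partialStr hF hI n i ≫ (G i).map (z (n + 1)) :=
    (isColimitOfPreserves (F i) hc).fac _ n
  let p : colimit D ⟶ X.X := hc.desc (coconeNat _ (fun n => (S.iterate hF hI n).p)
    (fun n => by
      rw [hD]
      exact S.transition_comp_p hF hI n))
  have hp (n : ℕ) : z n ≫ p = (S.iterate hF hI n).p := hc.fac _ n
  -- The object `S.Q` is the source `P` of the approximation at stage 1, hence the leg `z 1`.
  refine ⟨⟨colimit D, s⟩, isCardinalPresentable_colimit_nat κ hκ D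
    (fun n => (S.iterate hF hI n).presentable_P) c hc, ⟨p, fun i => ?_⟩, z 1, hp 1, fun i => ?_⟩
  · apply (isColimitOfPreserves (F i) hc).hom_ext
    intro n
    change (F i).map (z n) ≫ s i ≫ (G i).map p = (F i).map (z n) ≫ (F i).map p ≫ X.str i
    rw [reassoc_of% hs, ← Functor.map_comp, ← Functor.map_comp_assoc, hp, hp, partialStr_comp_map]
  · refine Eq.trans ?_ (hs 0 i)
    rw [← hz 0]
    rfl

end Approximation

include hF hI in
-- The equations imposed on the initial approximation, indexed by `K × I`, make every `Y k` map to
-- the resulting dialgebra by a morphism of dialgebras.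
theorem exists_enlargement (hκ : Cardinal.aleph0 < κ) [∀ i, Functor.IsFinitelyAccessible.{v} (F i)]
    {X : Dialgebra F G} {K : Type v} (hK : HasCardinalLT K κ) (Y : K → Dialgebra F G)
    (hY : ∀ k, IsCardinalPresentable (Y k).X κ) (f : ∀ k, Y k ⟶ X) {P : C}
    (hP : IsCardinalPresentable P κ) (p : P ⟶ X.X) (g : ∀ k, (Y k).X ⟶ P)
    (hg : ∀ k, g k ≫ p = (f k).hom) :
    ∃ (Z : Dialgebra F G) (_ : IsCardinalPresentable Z.X κ) (h : Z ⟶ X) (q : P ⟶ Z.X)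
      (t : ∀ k, Y k ⟶ Z), q ≫ h.hom = p ∧ (∀ k, t k ≫ h = f k) ∧ ∀ k, g k ≫ q = (t k).hom := by
  obtain ⟨Q, hQ, q, t, s, ht, hs, hks⟩ := exists_approximation κ hF hI X hP p
    (hasCardinalLT_prod (Cardinal.IsRegular.aleph0_le Fact.out) hK hI) (fun k => k.2)
    (fun k => (F k.2).obj (Y k.1).X) (fun k => hF _ _ (hY k.1)) (fun k => (F k.2).map (g k.1))
    (fun k => (Y k.1).str k.2 ≫ (G k.2).map (g k.1)) (fun k => by
      rw [Category.assoc, ← Functor.map_comp, ← Functor.map_comp_assoc, hg, (f k.1).comm])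
  let S : Approximation κ X := ⟨P, Q, hP, hQ, p, q, t, ht, s, hs⟩
  obtain ⟨Z, hZ, h, z, hz, hzs⟩ := S.exists_dialgebra hF hI hκ
  change Q ⟶ Z.X at z
  change z ≫ h.hom = q at hz
  refine ⟨Z, hZ, h, t ≫ z, fun k => ⟨g k ≫ t ≫ z, fun i => ?_⟩, by rw [Category.assoc, hz, ht],
    fun k => hom_ext (by simp [hz, ht, hg]), fun k => rfl⟩
  have h₁ : (F i).map (t ≫ z) ≫ Z.str i = s i ≫ (G i).map z := hzs i
  have h₂ : (F i).map (g k) ≫ s i = ((Y k).str i ≫ (G i).map (g k)) ≫ (G i).map t := hks (k, i)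
  rw [Functor.map_comp (F i), Category.assoc, h₁, reassoc_of% h₂]
  simp

include hF hI in
/-- The forgetful functor from dialgebras has presentable enlargements. -/
theorem hasPresentableEnlargements_forget (hκ : Cardinal.aleph0 < κ)
    [∀ i, Functor.IsFinitelyAccessible.{v} (F i)] :
    HasPresentableEnlargements (forget F G) κ :=
  fun _ _ hK Y hY f _ hP p g hg => exists_enlargement κ hF hI hκ hK Y hY f hP p g hg

end Dialgebra

end Inserter

/-! ### Full subcategories defined by equations -/

section Equifier

variable {C : Type u} [Category.{v} C] {E : Type u'} [Category.{v} E] {E' : Type u''}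
  [Category.{v} E'] {U : E ⥤ C} {V : E' ⥤ E}

/-- The functor corepresented by `X` is `V` followed by the one corepresented by `V.obj X`. -/
theorem isCardinalPresentable_of_fullyFaithful (V : E' ⥤ E) [V.Full] [V.Faithful]
    (κ : Cardinal.{v}) [Fact κ.IsRegular] [V.IsCardinalAccessible κ] (X : E')
    [IsCardinalPresentable (V.obj X) κ] : IsCardinalPresentable X κ :=
  Functor.isCardinalAccessible_of_natIso
    (show V ⋙ coyoneda.obj (op (V.obj X)) ≅ coyoneda.obj (op X) from
      NatIso.ofComponents (fun Y => (Functor.FullyFaithful.ofFullyFaithful V).homEquiv.symm.toIso)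
        (fun f => by
          ext g
          apply V.map_injective
          simp [Functor.FullyFaithful.homEquiv])) κ

theorem essentiallySmall_inverseImage_of_fullyFaithful (V : E' ⥤ E) [V.Full] [V.Faithful]
    (P : ObjectProperty E) [ObjectProperty.EssentiallySmall.{v} P] :
    ObjectProperty.EssentiallySmall.{v} (P.inverseImage V) := by
  obtain ⟨Q, _, hQ, hQ'⟩ :=
    (ObjectProperty.EssentiallySmall.of_le inf_le_left :
      ObjectProperty.EssentiallySmall.{v} (P ⊓ V.essImage)).exists_small_le
  have hV (Y : Subtype Q) : V.essImage Y.1 := (hQ _ Y.2).2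
  refine ⟨.ofObj fun Y : Subtype Q => (hV Y).witness, inferInstance, fun X hX => ?_⟩
  obtain ⟨Z, hZ, ⟨e⟩⟩ := hQ' (V.obj X) ⟨hX, V.obj_mem_essImage X⟩
  exact ⟨_, ⟨⟨Z, hZ⟩⟩, ⟨V.preimageIso (e ≪≫ (hV ⟨Z, hZ⟩).getIso.symm)⟩⟩

variable {Q : Type w} {H K : Q → C ⥤ C} (φ ψ : ∀ e, U ⋙ H e ⟶ U ⋙ K e)
  (hV : ∀ e X, (φ e).app (V.obj X) = (ψ e).app (V.obj X))
  (hV' : ∀ Y, (∀ e, (φ e).app Y = (ψ e).app Y) → V.essImage Y)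

include hV in
-- By naturality both sides agree on every leg of the cocone, and the images of the legs under `U ⋙
-- H e` are jointly epic.
theorem map_app_comp_app_eq {J : Type*} [Category* J] {D : J ⥤ E'} {c : Cocone (D ⋙ V)}
    (hc : IsColimit c) (e : Q) [PreservesColimit (D ⋙ V) (U ⋙ H e)] :
    (φ e).app c.pt = (ψ e).app c.pt := by
  apply (isColimitOfPreserves (U ⋙ H e) hc).hom_ext
  intro j
  have h₁ := (φ e).naturality (c.ι.app j)
  have h₂ := (ψ e).naturality (c.ι.app j)
  refine h₁.trans (Eq.trans ?_ h₂.symm)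
  exact congrArg (· ≫ (U ⋙ K e).map (c.ι.app j)) (hV e (D.obj j))

include hV hV' in
/-- A full subcategory defined by equations is closed under the colimits which are preserved by the
functors appearing in these equations. -/
theorem preservesColimitsOfShape_of_equations [V.Full] [V.Faithful] (J : Type*) [Category* J]
    [HasColimitsOfShape J E] [∀ e, PreservesColimitsOfShape J (U ⋙ H e)] :
    PreservesColimitsOfShape J V where
  preservesColimit {D} := by
    have hY := hV' (colimit (D ⋙ V)) fun e =>
      map_app_comp_app_eq φ ψ hV (colimit.isColimit (D ⋙ V)) e
    let := createsColimitOfFullyFaithfulOfIso (K := D) (F := V) hY.witness hY.getIso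
    infer_instance

theorem app_comp_map_eq_of_eq_comp (e : Q) {X Y Z : E} {f : X ⟶ Y} {g : Y ⟶ Z} {h : X ⟶ Z}
    (hfg : h = f ≫ g)
    (hf : (φ e).app X ≫ (K e).map (U.map f) = (ψ e).app X ≫ (K e).map (U.map f)) :
    (φ e).app X ≫ (U ⋙ K e).map h = (ψ e).app X ≫ (U ⋙ K e).map h := by
  simp [hfg, reassoc_of% hf]

namespace HasPresentableEnlargements

variable {κ : Cardinal.{v}} [Fact κ.IsRegular] (hU : HasPresentableEnlargements U κ)
  [IsCardinalLocallyPresentable C κ] (hQ : HasCardinalLT Q κ)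
  (hH : ∀ (e : Q) (X : C), IsCardinalPresentable X κ → IsCardinalPresentable ((H e).obj X) κ)
  [∀ e, (K e).IsCardinalAccessible κ]

include hU hQ hH in
-- The two sides of each equation on `Z` agree over `X`, hence over a presentable object between
-- `U.obj Z` and `U.obj X`, which is then enlarged to an object of `E`. The equations hold on `Z`
-- only after mapping to `Z'`, which is why this step is iterated.
theorem exists_equalizing {X : E} (hX : ∀ e, (φ e).app X = (ψ e).app X) (Z : E)
    (hZ : IsCardinalPresentable (U.obj Z) κ) (h : Z ⟶ X) :
    ∃ T : Σ (Z' : E) (_ : Z ⟶ Z'), Z' ⟶ X,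
      IsCardinalPresentable (U.obj T.1) κ ∧ T.2.1 ≫ T.2.2 = h ∧
      ∀ e, (φ e).app Z ≫ (K e).map (U.map T.2.1) = (ψ e).app Z ≫ (K e).map (U.map T.2.1) := by
  have (e : Q) := hH e _ hZ
  obtain ⟨R, hR, r, t, ht, htt⟩ := exists_presentable_equalization κ hQ (U.map h)
    (fun e => (H e).obj (U.obj Z)) K (fun e => (φ e).app Z) (fun e => (ψ e).app Z) fun e => by
      have h₁ := (φ e).naturality h
      have h₂ := (ψ e).naturality h
      rw [hX e] at h₁
      exact h₁.symm.trans h₂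
  obtain ⟨Z', hZ', h', q, t', -, ht', hq⟩ := hU.exists_between h r t ht
  refine ⟨⟨Z', t', h'⟩, hZ', ht', fun e => ?_⟩
  have := htt e
  simp only [← hq, Functor.map_comp, reassoc_of% this]

variable (U κ) in
/-- An object over `X` with a `κ`-presentable image. -/
structure PresentableOver (X : E) where
  /-- The object. -/
  Z : E
  /-- The projection. -/
  h : Z ⟶ X
  presentable : IsCardinalPresentable (U.obj Z) κ

variable {X : E} (hX : ∀ e, (φ e).app X = (ψ e).app X) (S : PresentableOver U κ X)

/-- The next object in the sequence of objects over `X`. -/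
noncomputable def nextOver (S : PresentableOver U κ X) : PresentableOver U κ X :=
  have h := (exists_equalizing φ ψ hU hQ hH hX S.Z S.presentable S.h).choose_spec
  { Z := (exists_equalizing φ ψ hU hQ hH hX S.Z S.presentable S.h).choose.1
    h := (exists_equalizing φ ψ hU hQ hH hX S.Z S.presentable S.h).choose.2.2
    presentable := h.1 }

/-- A sequence of objects over `X`. -/
noncomputable def sequenceOver : ℕ → PresentableOver U κ X
  | 0 => S
  | n + 1 => nextOver φ ψ hU hQ hH hX (sequenceOver n)

/-- The transition morphisms in the sequence of objects over `X`. -/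
noncomputable def transitionOver (n : ℕ) :
    (sequenceOver φ ψ hU hQ hH hX S n).Z ⟶ (sequenceOver φ ψ hU hQ hH hX S (n + 1)).Z :=
  (exists_equalizing φ ψ hU hQ hH hX (sequenceOver φ ψ hU hQ hH hX S n).Z
    (sequenceOver φ ψ hU hQ hH hX S n).presentable
    (sequenceOver φ ψ hU hQ hH hX S n).h).choose.2.1

theorem transitionOver_comp_h (n : ℕ) :
    transitionOver φ ψ hU hQ hH hX S n ≫ (sequenceOver φ ψ hU hQ hH hX S (n + 1)).h =
      (sequenceOver φ ψ hU hQ hH hX S n).h :=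
  (exists_equalizing φ ψ hU hQ hH hX (sequenceOver φ ψ hU hQ hH hX S n).Z
    (sequenceOver φ ψ hU hQ hH hX S n).presentable
    (sequenceOver φ ψ hU hQ hH hX S n).h).choose_spec.2.1

theorem app_comp_map_transitionOver (n : ℕ) (e : Q) :
    (φ e).app _ ≫ (K e).map (U.map (transitionOver φ ψ hU hQ hH hX S n)) =
      (ψ e).app _ ≫ (K e).map (U.map (transitionOver φ ψ hU hQ hH hX S n)) :=
  (exists_equalizing φ ψ hU hQ hH hX (sequenceOver φ ψ hU hQ hH hX S n).Z
    (sequenceOver φ ψ hU hQ hH hX S n).presentable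
    (sequenceOver φ ψ hU hQ hH hX S n).h).choose_spec.2.2 e

include hU hQ hH hX in
-- Every leg of the sequential colimit passes through the next stage, where the equations of the
-- current one have been forced; the functors `U ⋙ H e` preserve this colimit, so the equations hold
-- on it.
theorem exists_equations (hκ : Cardinal.aleph0 < κ) [HasColimitsOfShape ℕ E]
    [PreservesColimitsOfShape ℕ U] [∀ e, PreservesColimitsOfShape ℕ (H e)] :
    ∃ (Z : E) (_ : IsCardinalPresentable (U.obj Z) κ) (h : Z ⟶ X) (z : S.Z ⟶ Z),
      z ≫ h = S.h ∧ ∀ e, (φ e).app Z = (ψ e).app Z := by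
  let s := transitionOver φ ψ hU hQ hH hX S
  let D : ℕ ⥤ E := Functor.ofSequence s
  let c := colimit.cocone D
  let hc : IsColimit c := colimit.isColimit D
  have hD (n : ℕ) : D.map (homOfLE (n.le_add_right 1)) = s n :=
    Functor.ofSequence_map_homOfLE_succ _ n
  let h : colimit D ⟶ X := hc.desc (coconeNat _ (fun n => (sequenceOver φ ψ hU hQ hH hX S n).h)
    (fun n => by
      rw [hD]
      exact transitionOver_comp_h φ ψ hU hQ hH hX S n))
  refine ⟨colimit D, isCardinalPresentable_colimit_nat κ hκ (D ⋙ U)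
    (fun n => (sequenceOver φ ψ hU hQ hH hX S n).presentable) (U.mapCocone c)
      (isColimitOfPreserves U hc), h, c.ι.app 0, hc.fac _ 0, fun e => ?_⟩
  apply (isColimitOfPreserves (U ⋙ H e) hc).hom_ext
  intro n
  have h₁ := (φ e).naturality (c.ι.app n)
  have h₂ := (ψ e).naturality (c.ι.app n)
  refine h₁.trans (Eq.trans ?_ h₂.symm)
  have h₃ : c.ι.app n = s n ≫ c.ι.app (n + 1) := by
    rw [← hD]
    exact (c.w (homOfLE (n.le_add_right 1))).symm
  have h₄ := app_comp_map_transitionOver φ ψ hU hQ hH hX S n e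
  exact app_comp_map_eq_of_eq_comp φ ψ e h₃ h₄

include hU hQ hH hV hV' in
/-- If `U` has presentable enlargements, then so does its restriction to a full subcategory which is
defined by equations. -/
theorem comp_of_equations [V.Full] [V.Faithful] (hκ : Cardinal.aleph0 < κ)
    [HasColimitsOfShape ℕ E] [PreservesColimitsOfShape ℕ U]
    [∀ e, PreservesColimitsOfShape ℕ (H e)] : HasPresentableEnlargements (V ⋙ U) κ := by
  intro X L hL Y hY f P hP p g hg
  obtain ⟨Z₀, hZ₀, h₀, q₀, t₀, hq₀, ht₀, hgt₀⟩ := hU hL (fun k => V.obj (Y k)) hY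
    (fun k => V.map (f k)) hP p g hg
  obtain ⟨Z, hZ, h, z, hz, hzz⟩ := exists_equations φ ψ hU hQ hH (fun e => hV e X)
    ⟨Z₀, h₀, hZ₀⟩ hκ
  change Z₀ ⟶ Z at z
  change z ≫ h = h₀ at hz
  have hY := hV' Z hzz
  let e : V.obj hY.witness ≅ Z := hY.getIso
  refine ⟨hY.witness, isCardinalPresentable_of_iso (U.mapIso e.symm) κ, V.preimage (e.hom ≫ h),
    q₀ ≫ U.map (z ≫ e.inv), fun k => V.preimage (t₀ k ≫ z ≫ e.inv), ?_, fun k => ?_, fun k => ?_⟩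
  · simp only [Functor.comp_map, Functor.map_preimage]
    rw [Category.assoc, ← U.map_comp, Category.assoc, e.inv_hom_id_assoc, hz, hq₀]
  · apply V.map_injective
    simp [hz, ht₀]
  · simp only [Functor.comp_map, Functor.map_preimage]
    rw [U.map_comp (t₀ k), ← hgt₀, Category.assoc]

end HasPresentableEnlargements

end Equifier

/-! ### Raising the index of accessibility -/

section RaisingIndex

/-- A regular cardinal `l` bounds the number of `κ`-small subsets of `l`-small types. -/
def BoundsSmallSubsets (κ l : Cardinal.{v}) : Prop :=
  ∀ X : Type v, HasCardinalLT X l → HasCardinalLT { S : Set X // HasCardinalLT S κ } l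

/-- A set with at most `2 ^ m` elements has at most `(2 ^ m) ^ m = 2 ^ m` subsets of size at most
`m`. -/
theorem boundsSmallSubsets_succ_two_power {κ m : Cardinal.{v}} (hκ : κ ≤ m)
    (hm : Cardinal.aleph0 ≤ m) : BoundsSmallSubsets κ (Order.succ (2 ^ m)) := by
  intro X hX
  rw [hasCardinalLT_iff_cardinal_mk_lt, Order.lt_succ_iff] at hX ⊢
  have h₁ : Cardinal.mk { S : Set X // HasCardinalLT S κ } ≤
      Cardinal.mk { S : Set X // Cardinal.mk S ≤ m } :=
    Cardinal.mk_subtype_mono fun S hS =>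
      (((hasCardinalLT_iff_cardinal_mk_lt _ _).1 hS).trans_le hκ).le
  have h₂ : max (Cardinal.mk X) Cardinal.aleph0 ≤ 2 ^ m :=
    max_le hX (hm.trans (Cardinal.cantor m).le)
  calc _ ≤ max (Cardinal.mk X) Cardinal.aleph0 ^ m := h₁.trans (Cardinal.mk_bounded_set_le X m)
    _ ≤ (2 ^ m) ^ m := Cardinal.power_le_power_right h₂
    _ = 2 ^ m := by rw [← Cardinal.power_mul, Cardinal.mul_eq_self hm]

variable {C : Type u} [Category.{v} C] {C' : Type u'} [Category.{v} C'] {κ l : Cardinal.{v}}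
  [Fact κ.IsRegular]

section Subsets

variable {T : Type v} [PartialOrder T]

variable (κ l T) in
/-- The poset of `l`-small `κ`-directed subsets of a poset. -/
abbrev DirectedSubset : Type v := { B : Set T // IsCardinalFiltered B κ ∧ HasCardinalLT B l }

/-- The bound on small subsets makes `κ` sharply smaller than `l`: the family of all `κ`-small
subsets is trivially cofinal in itself. -/
theorem exists_directedSubset [Fact l.IsRegular] (hl : κ < l) (h : BoundsSmallSubsets κ l) [IsCardinalFiltered T κ]
    (S : Set T) (hS : HasCardinalLT S l) : ∃ B : DirectedSubset κ l T, S ⊆ B.1 := by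
  obtain ⟨B, hB, h₁, h₂⟩ := Cardinal.SharplyLT.exists_isCardinalFiltered_set_of_exists_cofinal hl
    (fun X hX => ⟨Set.univ, (h X hX).of_surjective (fun S => ⟨S, trivial⟩) fun S => ⟨S.1, rfl⟩,
      fun S => ⟨S, trivial, le_rfl⟩⟩) S hS
  exact ⟨⟨B, h₁, h₂⟩, hB⟩

theorem isCardinalFiltered_directedSubset [Fact l.IsRegular] (hl : κ < l) (h : BoundsSmallSubsets κ l)
    [IsCardinalFiltered T κ] : IsCardinalFiltered (DirectedSubset κ l T) l :=
  isCardinalFiltered_preorder _ _ fun K s hK => by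
    obtain ⟨B, hB⟩ := exists_directedSubset hl h (⋃ k, (s k).1)
      (hasCardinalLT_iUnion _ ((hasCardinalLT_iff_cardinal_mk_lt _ _).2 hK) fun k => (s k).2.2)
    exact ⟨B, fun k => (Set.subset_iUnion _ k).trans hB⟩

/-- The inclusion of a subset of a poset. -/
abbrev DirectedSubset.incl (B : DirectedSubset κ l T) : B.1 ⥤ T :=
  Monotone.functor (f := Subtype.val) fun _ _ h => h

variable (D : T ⥤ C) [HasColimitsOfSize.{v, v} C]

/-- The morphism to the colimit over a directed subset. -/
noncomputable def DirectedSubset.toColimit (B : DirectedSubset κ l T) (t : T) (ht : t ∈ B.1) :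
    D.obj t ⟶ colimit (B.incl ⋙ D) :=
  colimit.ι (B.incl ⋙ D) ⟨t, ht⟩

theorem DirectedSubset.map_comp_toColimit (B : DirectedSubset κ l T) {t t' : T} (f : t ⟶ t')
    (ht : t ∈ B.1) (ht' : t' ∈ B.1) : D.map f ≫ B.toColimit D t' ht' = B.toColimit D t ht :=
  colimit.w (B.incl ⋙ D) (j := ⟨t', ht'⟩) (j' := ⟨t, ht⟩) (homOfLE (leOfHom f))

variable {D} in
theorem DirectedSubset.colimit_hom_ext (B : DirectedSubset κ l T) {Y : C}
    {f g : colimit (B.incl ⋙ D) ⟶ Y}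
    (h : ∀ t ht, B.toColimit D t ht ≫ f = B.toColimit D t ht ≫ g) : f = g :=
  colimit.hom_ext fun b => h b.1 b.2

/-- The morphism from the colimit over a directed subset. -/
noncomputable def DirectedSubset.colimitDesc (B : DirectedSubset κ l T) {Y : C}
    (f : ∀ t, t ∈ B.1 → (D.obj t ⟶ Y))
    (hf : ∀ {t t'} ht ht' (g : t ⟶ t'), D.map g ≫ f t' ht' = f t ht) :
    colimit (B.incl ⋙ D) ⟶ Y :=
  colimit.desc (B.incl ⋙ D) (Cocone.mk Y
    { app b := f b.1 b.2
      naturality b b' _ := (hf b.2 b'.2 _).trans (Category.comp_id _).symm })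

theorem DirectedSubset.toColimit_colimitDesc (B : DirectedSubset κ l T) {Y : C}
    (f : ∀ t, t ∈ B.1 → (D.obj t ⟶ Y))
    (hf : ∀ {t t'} ht ht' (g : t ⟶ t'), D.map g ≫ f t' ht' = f t ht)
    (t : T) (ht : t ∈ B.1) : B.toColimit D t ht ≫ B.colimitDesc D f hf = f t ht :=
  colimit.ι_desc _ _

theorem DirectedSubset.toColimit_colimitDesc_assoc (B : DirectedSubset κ l T) {Y Z : C}
    (f : ∀ t, t ∈ B.1 → (D.obj t ⟶ Y))
    (hf : ∀ {t t'} ht ht' (g : t ⟶ t'), D.map g ≫ f t' ht' = f t ht)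
    (t : T) (ht : t ∈ B.1) (g : Y ⟶ Z) :
    B.toColimit D t ht ≫ B.colimitDesc D f hf ≫ g = f t ht ≫ g := by
  rw [← Category.assoc, toColimit_colimitDesc]

attribute [simp] DirectedSubset.toColimit_colimitDesc DirectedSubset.toColimit_colimitDesc_assoc

variable (κ l) in
/-- The diagram of the colimits over all directed subsets. -/
noncomputable def partialColimits : DirectedSubset κ l T ⥤ C where
  obj B := colimit (B.incl ⋙ D)
  map {B B'} f := B.colimitDesc D (fun t ht => B'.toColimit D t (leOfHom f ht))
    fun _ _ g => B'.map_comp_toColimit D g _ _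
  map_id B := B.colimit_hom_ext fun t ht => by simp
  map_comp f g := DirectedSubset.colimit_hom_ext _ fun t ht => by simp

/-- The morphism to the colimit over a directed subset. -/
noncomputable abbrev toPartialColimits (B : DirectedSubset κ l T) (t : T) (ht : t ∈ B.1) :
    D.obj t ⟶ (partialColimits κ l D).obj B :=
  B.toColimit D t ht

theorem toPartialColimits_map {B B' : DirectedSubset κ l T} (f : B ⟶ B') (t : T) (ht : t ∈ B.1) :
    toPartialColimits D B t ht ≫ (partialColimits κ l D).map f =
      toPartialColimits D B' t (leOfHom f ht) :=
  B.toColimit_colimitDesc D (fun t ht => B'.toColimit D t (leOfHom f ht))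
    (fun _ _ g => B'.map_comp_toColimit D g _ _) t ht

theorem toPartialColimits_eq {B B' : DirectedSubset κ l T} (f : B ⟶ B') (t : T) (ht : t ∈ B.1)
    (s : Cocone (partialColimits κ l D)) :
    toPartialColimits D B t ht ≫ s.ι.app B =
      toPartialColimits D B' t (leOfHom f ht) ≫ s.ι.app B' := by
  rw [← s.w f, ← Category.assoc, toPartialColimits_map]

variable {D} (c : Cocone D)

variable (κ l) in
/-- The cocone on the partial colimits. -/
noncomputable def partialColimitsCocone : Cocone (partialColimits κ l D) :=
  Cocone.mk c.pt
    { app B := B.colimitDesc D (fun t _ => c.ι.app t) fun _ _ g => c.w g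
      naturality B B' f := B.colimit_hom_ext fun t ht => by
        refine (Category.assoc _ _ _).symm.trans
          ((congrArg (· ≫ B'.colimitDesc D _ _) (toPartialColimits_map D f t ht)).trans ?_)
        refine (B'.toColimit_colimitDesc D _ _ _ _).trans ?_
        exact ((congrArg (B.toColimit D t ht ≫ ·) (Category.comp_id _)).trans
          (B.toColimit_colimitDesc D (fun t _ => c.ι.app t) (fun _ _ g => c.w g) t ht)).symm }

theorem toPartialColimits_comp_app (B : DirectedSubset κ l T) (t : T) (ht : t ∈ B.1) :
    toPartialColimits D B t ht ≫ (partialColimitsCocone κ l c).ι.app B = c.ι.app t :=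
  B.toColimit_colimitDesc D (fun t _ => c.ι.app t) (fun _ _ g => c.w g) t ht

/-- A colimit over a directed poset is the colimit of the partial colimits. -/
noncomputable def isColimitPartialColimitsCocone [Fact l.IsRegular] (hl : κ < l) (h : BoundsSmallSubsets κ l)
    [IsCardinalFiltered T κ] (hc : IsColimit c) :
    IsColimit (partialColimitsCocone κ l c) := by
  have hT (S : Set T) (hS : S.Finite) := exists_directedSubset hl h S
    (have := hS.to_subtype; hasCardinalLT_of_finite _ _ (Cardinal.IsRegular.aleph0_le Fact.out))
  choose B hB using hT
  let B₁ (t : T) : DirectedSubset κ l T := B {t} (Set.finite_singleton t)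
  have hB₁ (t : T) : t ∈ (B₁ t).1 := hB _ _ rfl
  -- The map induced on `D.obj t` does not depend on the directed subset chosen to contain `t`,
  -- since two such subsets lie in a third.
  have key (s : Cocone (partialColimits κ l D)) (t : T) (B₂ : DirectedSubset κ l T)
      (ht : t ∈ B₂.1) : toPartialColimits D (B₁ t) t (hB₁ t) ≫ s.ι.app (B₁ t) =
        toPartialColimits D B₂ t ht ≫ s.ι.app B₂ := by
    have := isCardinalFiltered_directedSubset (T := T) hl h
    have := isFiltered_of_isCardinalFiltered (DirectedSubset κ l T) l
    rw [toPartialColimits_eq D (IsFiltered.leftToMax (B₁ t) B₂),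
      toPartialColimits_eq D (IsFiltered.rightToMax (B₁ t) B₂)]
  let d (s : Cocone (partialColimits κ l D)) : Cocone D := Cocone.mk s.pt
    { app t := toPartialColimits D (B₁ t) t (hB₁ t) ≫ s.ι.app (B₁ t)
      naturality t t' f := by
        let B₂ := B {t, t'} (Set.toFinite _)
        have ht : t ∈ B₂.1 := hB _ _ (by simp)
        have ht' : t' ∈ B₂.1 := hB _ _ (by simp)
        rw [key s t B₂ ht, key s t' B₂ ht']
        exact (Category.assoc _ _ _).symm.trans
          ((congrArg (· ≫ s.ι.app B₂) (B₂.map_comp_toColimit D f ht ht')).trans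
            (Category.comp_id _).symm) }
  refine
    { desc s := hc.desc (d s)
      fac s B₂ := B₂.colimit_hom_ext fun t ht => ?_
      uniq s m hm := hc.hom_ext fun t => ?_ }
  · have h₁ := toPartialColimits_comp_app c B₂ t ht
    refine (Category.assoc _ _ _).symm.trans ((congrArg (· ≫ hc.desc (d s)) h₁).trans ?_)
    exact (hc.fac (d s) t).trans (key s t B₂ ht)
  · rw [hc.fac, ← toPartialColimits_comp_app (κ := κ) (l := l) c (B₁ t) t (hB₁ t)]
    exact (Category.assoc _ _ _).trans
      (congrArg (toPartialColimits D (B₁ t) t (hB₁ t) ≫ ·) (hm (B₁ t)))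

end Subsets

theorem hasCardinalLT_arrow_of_preorder [Fact l.IsRegular] {T : Type v} [Preorder T] (hT : HasCardinalLT T l) :
    HasCardinalLT (Arrow T) l :=
  (hasCardinalLT_prod (Cardinal.IsRegular.aleph0_le Fact.out) hT hT).of_injective
    (fun a : Arrow T => (a.left, a.right)) fun a b h => by
      obtain ⟨a₁, a₂, f⟩ := a
      obtain ⟨b₁, b₂, g⟩ := b
      obtain ⟨rfl, rfl⟩ := Prod.ext_iff.1 h
      exact congrArg _ (Subsingleton.elim (α := a₁ ⟶ a₂) f g)

/-- A `κ`-accessible functor which sends `κ`-presentable objects to `l`-presentable objects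
preserves `l`-presentable objects, if `κ` is sharply smaller than `l`. -/
theorem isCardinalPresentable_obj_of_boundsSmallSubsets [Fact l.IsRegular] [IsCardinalLocallyPresentable C κ]
    (hl : κ < l) (h : BoundsSmallSubsets κ l) (F : C ⥤ C') [F.IsCardinalAccessible κ]
    (hF : ∀ X, IsCardinalPresentable X κ → IsCardinalPresentable (F.obj X) l) (X : C)
    [IsCardinalPresentable X l] : IsCardinalPresentable (F.obj X) l := by
  obtain ⟨J, _, _, ⟨p⟩⟩ :=
    (isCardinalFilteredGenerator_isCardinalPresentable C κ).exists_colimitsOfShape X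
  obtain ⟨T, _, _, G, _⟩ := IsCardinalFiltered.exists_cardinal_directed J κ
  let c := (p.reindex G).cocone
  have hc : IsColimit c := (p.reindex G).isColimit
  have := isCardinalFiltered_directedSubset (T := T) hl h
  -- The identity of `X` factors through a partial colimit, so `X` is a retract of a colimit of
  -- `κ`-presentable objects over some `l`-small `κ`-directed `B`. The functor `F` preserves that
  -- colimit, and `l`-presentable objects are closed under `l`-small colimits and retracts.
  obtain ⟨B, i, hi⟩ := IsCardinalPresentable.exists_hom_of_isColimit l
    (isColimitPartialColimitsCocone c hl h hc) (𝟙 X)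
  have := B.2.1
  have := F.preservesColimitsOfShape_of_isCardinalAccessible κ B.1
  have hB (b : B.1) : IsCardinalPresentable (((B.incl ⋙ (p.reindex G).diag) ⋙ F).obj b) l :=
    hF _ (p.prop_diag_obj _)
  have : IsCardinalPresentable (F.obj ((partialColimits κ l (p.reindex G).diag).obj B)) l :=
    isCardinalPresentable_of_isColimit _
      (isColimitOfPreserves F (colimit.isColimit (B.incl ⋙ (p.reindex G).diag))) l
      (hasCardinalLT_arrow_of_preorder B.2.2)
  exact Retract.isCardinalPresentable
    (Retract.map ⟨i, (partialColimitsCocone κ l c).ι.app B, hi⟩ F) l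

end RaisingIndex

section LargeCardinals

theorem exists_boundsSmallSubsets (κ κ₀ : Cardinal.{v}) :
    ∃ (l : Cardinal.{v}) (_ : Fact l.IsRegular),
      κ < l ∧ κ₀ < l ∧ Cardinal.aleph0 < l ∧ BoundsSmallSubsets κ l := by
  let m := max κ (max κ₀ Cardinal.aleph0)
  have h₁ : κ ≤ m := le_max_left _ _
  have h₂ : κ₀ ≤ m := (le_max_left _ _).trans (le_max_right _ _)
  have h₃ : Cardinal.aleph0 ≤ m := (le_max_right _ _).trans (le_max_right _ _)
  have h₄ : m < Order.succ (2 ^ m) := (Cardinal.cantor m).trans (Order.lt_succ _)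
  exact ⟨Order.succ (2 ^ m), ⟨Cardinal.isRegular_succ (h₃.trans (Cardinal.cantor m).le)⟩,
    h₁.trans_lt h₄, h₂.trans_lt h₄, h₃.trans_lt h₄, boundsSmallSubsets_succ_two_power h₁ h₃⟩

end LargeCardinals

/-! ### Finitary functors and tensor products -/

section Finitary

variable {C D : Type u} [Category.{v} C] [Category.{v} D]

/-- Every small filtered category receives a final functor from a directed poset. -/
theorem PreservesDirectedColimits.isFinitelyAccessible {F : C ⥤ D}
    (hF : PreservesDirectedColimits F) : Functor.IsFinitelyAccessible.{v} F where
  preservesColimitOfShape J _ _ := by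
    have := isFiltered_of_isCardinalFiltered J Cardinal.aleph0.{v}
    obtain ⟨T, _, _, _, G, _⟩ := IsFiltered.exists_directed J
    have := hF T
    exact Functor.Final.preservesColimitsOfShape_of_final G F

variable {A : Type u} [Category.{v} A] [MonoidalCategory A]

/-- The pointwise tensor product of two functors. -/
@[simps]
def tensorFunctors (F G : A ⥤ A) : A ⥤ A where
  obj X := F.obj X ⊗ G.obj X
  map f := F.map f ⊗ₘ G.map f

/-- The tensor product preserves filtered colimits in each variable, hence turns two of them into a
colimit over `J × J`; the diagonal of a filtered `J` is final, which reduces this to a colimit over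
`J`. -/
theorem isFinitelyAccessible_tensorFunctors
    (hleft : ∀ X : A, Functor.IsFinitelyAccessible.{v} (tensorLeft X))
    (hright : ∀ X : A, Functor.IsFinitelyAccessible.{v} (tensorRight X)) (F G : A ⥤ A)
    [Functor.IsFinitelyAccessible.{v} F] [Functor.IsFinitelyAccessible.{v} G] :
    Functor.IsFinitelyAccessible.{v} (tensorFunctors F G) where
  preservesColimitOfShape J _ _ := by
    have := isFiltered_of_isCardinalFiltered J Cardinal.aleph0.{v}
    have := F.preservesColimitsOfShape_of_isCardinalAccessible Cardinal.aleph0.{v} J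
    have := G.preservesColimitsOfShape_of_isCardinalAccessible Cardinal.aleph0.{v} J
    have (X : A) : PreservesColimitsOfShape J ((curriedTensor A).obj X) :=
      (tensorLeft X).preservesColimitsOfShape_of_isCardinalAccessible Cardinal.aleph0.{v} J
    have (X : A) : PreservesColimitsOfShape J ((curriedTensor A).flip.obj X) :=
      (tensorRight X).preservesColimitsOfShape_of_isCardinalAccessible Cardinal.aleph0.{v} J
    refine ⟨fun {K} => ⟨fun {c} hc => ⟨?_⟩⟩⟩
    have h := (Functor.Final.isColimitWhiskerEquiv (Functor.diag J) _).symm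
      (isColimitOfPreserves₂ (curriedTensor A) (isColimitOfPreserves F hc)
        (isColimitOfPreserves G hc))
    let e : Functor.diag J ⋙ Functor.uncurry.obj ((((Functor.whiskeringLeft₂ A).obj (K ⋙ F)).obj
        (K ⋙ G)).obj (curriedTensor A)) ≅ K ⋙ tensorFunctors F G :=
      NatIso.ofComponents (fun j => Iso.refl (F.obj (K.obj j) ⊗ G.obj (K.obj j))) fun f =>
        (Category.comp_id _).trans ((MonoidalCategory.tensorHom_def _ _).symm.trans
          (Category.id_comp _).symm)
    let c' : Cocone (Functor.diag J ⋙ Functor.uncurry.obj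
        ((((Functor.whiskeringLeft₂ A).obj (K ⋙ F)).obj (K ⋙ G)).obj (curriedTensor A))) :=
      Cocone.whisker (Functor.diag J)
        ((curriedTensor A).mapCocone₂ (F.mapCocone c) (G.mapCocone c))
    let i : ((Cocone.precompose e.inv).obj c').pt ≅ ((tensorFunctors F G).mapCocone c).pt :=
      Iso.refl (F.obj c.pt ⊗ G.obj c.pt)
    exact IsColimit.equivOfNatIsoOfIso e c' ((tensorFunctors F G).mapCocone c)
      (Cocone.ext i fun j => (Category.comp_id _).trans ((Category.id_comp _).trans
        (MonoidalCategory.tensorHom_def _ _).symm)) h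

/-- In a locally presentable monoidal category, there are arbitrarily large regular cardinals `l`
such that the tensor product of `l`-presentable objects is `l`-presentable. -/
theorem exists_isCardinalPresentable_tensor [IsLocallyPresentable.{v} A]
    (hleft : ∀ X : A, Functor.IsFinitelyAccessible.{v} (tensorLeft X))
    (hright : ∀ X : A, Functor.IsFinitelyAccessible.{v} (tensorRight X)) (κ₀ : Cardinal.{v}) :
    ∃ (l : Cardinal.{v}) (_ : Fact l.IsRegular), κ₀ ≤ l ∧ Cardinal.aleph0 < l ∧
      IsCardinalLocallyPresentable A l ∧ IsCardinalPresentable (𝟙_ A) l ∧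
      ∀ X Y : A, IsCardinalPresentable X l → IsCardinalPresentable Y l →
        IsCardinalPresentable (X ⊗ Y) l := by
  obtain ⟨κ, _, _⟩ := IsLocallyPresentable.exists_cardinal.{v} A
  obtain ⟨Q, _, -, hQ⟩ :=
    ObjectProperty.EssentiallySmall.exists_small_le.{v} (isCardinalPresentable A κ)
  choose c hc hc' using fun X : A => (inferInstance : IsPresentable.{v} X).exists_cardinal
  -- The bound covers the ranks of the unit and of all tensor products of representatives of the
  -- `κ`-presentable objects, a supremum over a small set.
  obtain ⟨l, hl, h₁, h₂, h₃, h₄⟩ := exists_boundsSmallSubsets κ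
    (max κ₀ (max (c (𝟙_ A)) (⨆ p : Subtype Q × Subtype Q, c (p.1.1 ⊗ p.2.1))))
  have hk (X : A) (hX : c X ≤ l) : IsCardinalPresentable X l := by
    have := hc X
    have : IsCardinalPresentable X (c X) := hc' X
    exact isCardinalPresentable_of_le _ hX
  have hκ (F : A ⥤ A) (hF : Functor.IsFinitelyAccessible.{v} F) : F.IsCardinalAccessible κ :=
    F.isCardinalAccessible_of_le (Cardinal.IsRegular.aleph0_le Fact.out)
  have hl₁ (X Y : A) (hX : IsCardinalPresentable X κ) (hY : IsCardinalPresentable Y κ) :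
      IsCardinalPresentable (X ⊗ Y) l := by
    obtain ⟨X', hX', ⟨e⟩⟩ := hQ X hX
    obtain ⟨Y', hY', ⟨e'⟩⟩ := hQ Y hY
    have := hk (X' ⊗ Y') (((le_ciSup (f := fun p : Subtype Q × Subtype Q => c (p.1.1 ⊗ p.2.1))
      Cardinal.bddAbove_of_small (⟨X', hX'⟩, ⟨Y', hY'⟩)).trans
        ((le_max_right _ _).trans (le_max_right _ _))).trans h₂.le)
    exact isCardinalPresentable_of_iso (e ⊗ᵢ e').symm l
  -- The index is raised from `κ` to `l` in one variable at a time, here the second and at the end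
  -- the first.
  have hl₂ (X Y : A) (hX : IsCardinalPresentable X κ) (hY : IsCardinalPresentable Y l) :
      IsCardinalPresentable (X ⊗ Y) l := by
    have := hκ _ (hleft X)
    exact isCardinalPresentable_obj_of_boundsSmallSubsets h₁ h₄ (tensorLeft X)
      (fun Y hY => hl₁ X Y hX hY) Y
  refine ⟨l, hl, (le_max_left _ _).trans h₂.le, h₃, IsCardinalLocallyPresentable.of_le A h₁.le,
    hk _ (((le_max_left _ _).trans (le_max_right _ _)).trans h₂.le), fun X Y hX hY => ?_⟩
  have := hκ _ (hright Y)
  exact isCardinalPresentable_obj_of_boundsSmallSubsets h₁ h₄ (tensorRight Y)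
    (fun X hX => hl₂ X Y hX hY) X

end Finitary

/-! ### Dialgebras satisfying finitary equations -/

section Equations

variable {C : Type u} [Category.{v} C] {I Q : Type} {F G : I → C ⥤ C}
  {H K : Q → C ⥤ C}

theorem Dialgebra.hasColimitsOfShape (J : Type*) [Category* J] [HasColimitsOfShape J C]
    [∀ i, PreservesColimitsOfShape J (F i)] :
    HasColimitsOfShape J (Dialgebra F G) :=
  have : CreatesColimitsOfShape J (forget F G) := ⟨inferInstance⟩
  hasColimitsOfShape_of_hasColimitsOfShape_createsColimitsOfShape (forget F G)

theorem Dialgebra.preservesColimitsOfShape_forget (J : Type*) [Category* J]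
    [HasColimitsOfShape J C] [∀ i, PreservesColimitsOfShape J (F i)] :
    PreservesColimitsOfShape J (forget F G) :=
  ⟨inferInstance⟩

variable {E : Type u'} [Category.{v} E] (V : E ⥤ Dialgebra F G) [V.Full] [V.Faithful]
  (φ ψ : ∀ e, Dialgebra.forget F G ⋙ H e ⟶ Dialgebra.forget F G ⋙ K e)
  (hV : ∀ e X, (φ e).app (V.obj X) = (ψ e).app (V.obj X))
  (hV' : ∀ Y, (∀ e, (φ e).app Y = (ψ e).app Y) → V.essImage Y)
  [Finite I] [Finite Q]
  [∀ i, Functor.IsFinitelyAccessible.{v} (F i)] [∀ i, Functor.IsFinitelyAccessible.{v} (G i)]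
  [∀ e, Functor.IsFinitelyAccessible.{v} (H e)] [∀ e, Functor.IsFinitelyAccessible.{v} (K e)]

theorem CategoryTheory.Functor.IsFinitelyAccessible.isCardinalAccessible (F : C ⥤ C)
    [Functor.IsFinitelyAccessible.{v} F] (κ : Cardinal.{v}) [Fact κ.IsRegular] :
    F.IsCardinalAccessible κ :=
  F.isCardinalAccessible_of_le (Cardinal.IsRegular.aleph0_le Fact.out)

variable (F H) in
/-- A regular cardinal is adapted to operations and equations if their sources preserve presentable
objects. -/
structure IsAdaptedCardinal (κ : Cardinal.{v}) [Fact κ.IsRegular] : Prop where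
  aleph0_lt : Cardinal.aleph0 < κ
  isCardinalLocallyPresentable : IsCardinalLocallyPresentable C κ
  operations (i : I) (X : C) : IsCardinalPresentable X κ → IsCardinalPresentable ((F i).obj X) κ
  equations (e : Q) (X : C) : IsCardinalPresentable X κ → IsCardinalPresentable ((H e).obj X) κ

section

variable {κ : Cardinal.{v}} [Fact κ.IsRegular] (hκ : IsAdaptedCardinal F H κ)

include hκ hV hV'

theorem hasPresentableEnlargements_of_equations :
    HasPresentableEnlargements (V ⋙ Dialgebra.forget F G) κ := by
  have := hκ.isCardinalLocallyPresentable
  have (i : I) := Functor.IsFinitelyAccessible.isCardinalAccessible (G i) κ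
  have (e : Q) := Functor.IsFinitelyAccessible.isCardinalAccessible (K e) κ
  have (i : I) := preservesColimitsOfShape_nat_of_isFinitelyAccessible (F i)
  have (e : Q) := preservesColimitsOfShape_nat_of_isFinitelyAccessible (H e)
  have := hasColimitsOfShape_nat (C := C)
  have := Dialgebra.hasColimitsOfShape (F := F) (G := G) ℕ
  have := Dialgebra.preservesColimitsOfShape_forget (F := F) (G := G) ℕ
  exact (Dialgebra.hasPresentableEnlargements_forget κ hκ.operations
    (hasCardinalLT_of_finite _ _ hκ.aleph0_lt.le) hκ.aleph0_lt).comp_of_equations φ ψ hV hV'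
      (hasCardinalLT_of_finite _ _ hκ.aleph0_lt.le) hκ.equations hκ.aleph0_lt

omit hV hV' [Finite I] [Finite Q] [∀ i, Functor.IsFinitelyAccessible.{v} (F i)]
  [∀ i, Functor.IsFinitelyAccessible.{v} (G i)] [∀ e, Functor.IsFinitelyAccessible.{v} (H e)] in
theorem essentiallySmall_inverseImage_of_equations :
    ObjectProperty.EssentiallySmall.{v}
      ((isCardinalPresentable C κ).inverseImage (V ⋙ Dialgebra.forget F G)) := by
  have := hκ.isCardinalLocallyPresentable
  have := Dialgebra.essentiallySmall_inverseImage_forget (F := F) (G := G)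
    (isCardinalPresentable C κ)
  exact essentiallySmall_inverseImage_of_fullyFaithful V
    ((isCardinalPresentable C κ).inverseImage (Dialgebra.forget F G))

omit [Finite Q] [∀ e, Functor.IsFinitelyAccessible.{v} (K e)] in
-- The object is presentable as a dialgebra, and this passes to the full subcategory because
-- equations with finitary sources are stable under `κ`-filtered colimits.
theorem inverseImage_le_isCardinalPresentable_of_equations :
    (isCardinalPresentable C κ).inverseImage (V ⋙ Dialgebra.forget F G) ≤
      isCardinalPresentable E κ := by
  have := hκ.isCardinalLocallyPresentable
  intro X (hX : IsCardinalPresentable (V.obj X).X κ)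
  have (i : I) := Functor.IsFinitelyAccessible.isCardinalAccessible (F i) κ
  have (i : I) := Functor.IsFinitelyAccessible.isCardinalAccessible (G i) κ
  have (e : Q) := Functor.IsFinitelyAccessible.isCardinalAccessible (H e) κ
  have (i : I) := hκ.operations i _ hX
  have := Dialgebra.isCardinalPresentable κ (hasCardinalLT_of_finite _ _ hκ.aleph0_lt.le) (V.obj X)
  have : V.IsCardinalAccessible κ :=
    { preservesColimitOfShape J _ _ := by
        have (i : I) := (F i).preservesColimitsOfShape_of_isCardinalAccessible κ J
        have (e : Q) := (H e).preservesColimitsOfShape_of_isCardinalAccessible κ J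
        have := Dialgebra.hasColimitsOfShape (F := F) (G := G) J
        have := Dialgebra.preservesColimitsOfShape_forget (F := F) (G := G) J
        exact preservesColimitsOfShape_of_equations φ ψ hV hV' J }
  exact isCardinalPresentable_of_fullyFaithful V κ X

end

variable (hlarge : ∀ κ₀ : Cardinal.{v}, ∃ (κ : Cardinal.{v}) (_ : Fact κ.IsRegular), κ₀ ≤ κ ∧
  IsAdaptedCardinal F H κ)

include hV hV' hlarge

/-- Complete categories of dialgebras satisfying finitary equations are cocomplete. -/
theorem hasColimitsOfSize_of_equations [IsLocallyPresentable.{v} C]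
    [HasLimitsOfSize.{v, v} E] : HasColimitsOfSize.{v, v} E := by
  obtain ⟨κ, _, _⟩ := IsLocallyPresentable.exists_cardinal.{v} C
  exact hasColimitsOfSize_of_hasPresentableEnlargements (V ⋙ Dialgebra.forget F G)
    (fun X => inferInstance) fun κ₀ => by
      obtain ⟨κ, _, h, hκ⟩ := hlarge κ₀
      exact ⟨κ, inferInstance, h, hasPresentableEnlargements_of_equations V φ ψ hV hV' hκ,
        essentiallySmall_inverseImage_of_equations V hκ⟩

/-- Cocomplete categories of dialgebras satisfying finitary equations are locally presentable. -/
theorem isLocallyPresentable_of_equations [HasColimitsOfSize.{v, v} E] :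
    IsLocallyPresentable.{v} E := by
  obtain ⟨κ, _, -, hκ⟩ := hlarge 0
  have := hκ.isCardinalLocallyPresentable
  have := essentiallySmall_inverseImage_of_equations V hκ
  have := (hasPresentableEnlargements_of_equations V φ ψ hV hV' hκ).isCardinalLocallyPresentable
    (inverseImage_le_isCardinalPresentable_of_equations V φ ψ hV hV' hκ)
  exact ⟨κ, inferInstance, this⟩

end Equations

/-! ### Commutative monoids as dialgebras with equations -/

/-- The operations of monoids. -/
inductive MonOp
  | one
  | mul

/-- The equations of commutative monoids. -/
inductive CommMonEq
  | one_mul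
  | mul_one
  | mul_assoc
  | mul_comm

instance : Finite MonOp :=
  Finite.of_surjective (fun b : Bool => if b then .mul else .one)
    fun | .one => ⟨false, rfl⟩ | .mul => ⟨true, rfl⟩

instance : Finite CommMonEq :=
  Finite.of_surjective (fun b : Bool × Bool =>
    if b.1 then (if b.2 then .one_mul else .mul_one) else if b.2 then .mul_assoc else .mul_comm)
    fun
    | .one_mul => ⟨(true, true), rfl⟩
    | .mul_one => ⟨(true, false), rfl⟩
    | .mul_assoc => ⟨(false, true), rfl⟩
    | .mul_comm => ⟨(false, false), rfl⟩

section CommMonDialgebra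

variable (A : Type u) [Category.{v} A] [MonoidalCategory A]

/-- The sources of the operations of monoids. -/
def MonOp.source : MonOp → A ⥤ A
  | one => (Functor.const A).obj (𝟙_ A)
  | mul => tensorFunctors (𝟭 A) (𝟭 A)

/-- Objects with a multiplication and a unit, without any axioms. -/
abbrev UnitalMagma : Type (max u v) := Dialgebra (MonOp.source A) fun _ => 𝟭 A

/-- The sources of the equations of commutative monoids. -/
def CommMonEq.source : CommMonEq → A ⥤ A
  | one_mul => 𝟭 A
  | mul_one => 𝟭 A
  | mul_assoc => tensorFunctors (tensorFunctors (𝟭 A) (𝟭 A)) (𝟭 A)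
  | mul_comm => tensorFunctors (𝟭 A) (𝟭 A)

variable {A}

namespace UnitalMagma

/-- The unit. -/
def one (X : UnitalMagma A) : 𝟙_ A ⟶ X.X := X.str .one

/-- The multiplication. -/
def mul (X : UnitalMagma A) : X.X ⊗ X.X ⟶ X.X := X.str .mul

variable {X Y : UnitalMagma A} (f : X ⟶ Y)

theorem one_hom : X.one ≫ f.hom = Y.one :=
  (f.comm .one).trans (Category.id_comp _)

theorem mul_hom : X.mul ≫ f.hom = (f.hom ⊗ₘ f.hom) ≫ Y.mul :=
  f.comm .mul

theorem one_mul_naturality : f.hom ≫ (λ_ Y.X).inv ≫ Y.one ▷ Y.X ≫ Y.mul =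
    ((λ_ X.X).inv ≫ X.one ▷ X.X ≫ X.mul) ≫ f.hom := by
  rw [Category.assoc, Category.assoc, mul_hom, MonoidalCategory.tensorHom_def,
    leftUnitor_inv_naturality_assoc, whisker_exchange_assoc, Category.assoc,
    ← comp_whiskerRight_assoc, one_hom]

theorem mul_one_naturality : f.hom ≫ (ρ_ Y.X).inv ≫ Y.X ◁ Y.one ≫ Y.mul =
    ((ρ_ X.X).inv ≫ X.X ◁ X.one ≫ X.mul) ≫ f.hom := by
  rw [Category.assoc, Category.assoc, mul_hom, MonoidalCategory.tensorHom_def',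
    rightUnitor_inv_naturality_assoc, ← whisker_exchange_assoc, Category.assoc,
    ← MonoidalCategory.whiskerLeft_comp_assoc, one_hom]

theorem mul_mul_left_naturality : ((f.hom ⊗ₘ f.hom) ⊗ₘ f.hom) ≫ Y.mul ▷ Y.X ≫ Y.mul =
    (X.mul ▷ X.X ≫ X.mul) ≫ f.hom := by
  rw [Category.assoc, mul_hom, ← tensorHom_id, ← tensorHom_id, tensorHom_comp_tensorHom_assoc,
    tensorHom_comp_tensorHom_assoc, ← mul_hom, Category.comp_id, Category.id_comp]

theorem mul_mul_right_naturality :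
    ((f.hom ⊗ₘ f.hom) ⊗ₘ f.hom) ≫ (α_ Y.X Y.X Y.X).hom ≫ Y.X ◁ Y.mul ≫ Y.mul =
      ((α_ X.X X.X X.X).hom ≫ X.X ◁ X.mul ≫ X.mul) ≫ f.hom := by
  rw [Category.assoc, Category.assoc, mul_hom, ← id_tensorHom, ← id_tensorHom,
    associator_naturality_assoc, tensorHom_comp_tensorHom_assoc, tensorHom_comp_tensorHom_assoc,
    ← mul_hom, Category.comp_id, Category.id_comp]

theorem braiding_mul_naturality [BraidedCategory A] :
    (f.hom ⊗ₘ f.hom) ≫ (β_ Y.X Y.X).hom ≫ Y.mul = ((β_ X.X X.X).hom ≫ X.mul) ≫ f.hom := by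
  rw [Category.assoc, mul_hom, BraidedCategory.braiding_naturality_assoc]

end UnitalMagma

variable (A) [BraidedCategory A]

/-- The left-hand sides of the equations of commutative monoids. -/
def CommMonEq.lhs : ∀ e : CommMonEq,
    Dialgebra.forget (MonOp.source A) (fun _ => 𝟭 A) ⋙ e.source A ⟶
      Dialgebra.forget (MonOp.source A) (fun _ => 𝟭 A) ⋙ 𝟭 A
  | one_mul =>
    { app X := (λ_ X.X).inv ≫ UnitalMagma.one X ▷ X.X ≫ UnitalMagma.mul X
      naturality _ _ f := UnitalMagma.one_mul_naturality f }
  | mul_one =>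
    { app X := (ρ_ X.X).inv ≫ X.X ◁ UnitalMagma.one X ≫ UnitalMagma.mul X
      naturality _ _ f := UnitalMagma.mul_one_naturality f }
  | mul_assoc =>
    { app X := UnitalMagma.mul X ▷ X.X ≫ UnitalMagma.mul X
      naturality _ _ f := UnitalMagma.mul_mul_left_naturality f }
  | mul_comm =>
    { app X := (β_ X.X X.X).hom ≫ UnitalMagma.mul X
      naturality _ _ f := UnitalMagma.braiding_mul_naturality f }

/-- The right-hand sides of the equations of commutative monoids. -/
def CommMonEq.rhs : ∀ e : CommMonEq,
    Dialgebra.forget (MonOp.source A) (fun _ => 𝟭 A) ⋙ e.source A ⟶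
      Dialgebra.forget (MonOp.source A) (fun _ => 𝟭 A) ⋙ 𝟭 A
  | one_mul => 𝟙 _
  | mul_one => 𝟙 _
  | mul_assoc =>
    { app X := (α_ X.X X.X X.X).hom ≫ X.X ◁ UnitalMagma.mul X ≫ UnitalMagma.mul X
      naturality _ _ f := UnitalMagma.mul_mul_right_naturality f }
  | mul_comm =>
    { app X := UnitalMagma.mul X
      naturality _ _ f := (UnitalMagma.mul_hom f).symm }

/-- The underlying unital magma of a commutative monoid. -/
def CategoryTheory.CommMon.toUnitalMagma : CommMon A ⥤ UnitalMagma A where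
  obj M :=
    { X := M.X
      str
        | .one => η[M.X]
        | .mul => μ[M.X] }
  map f :=
    { hom := f.hom.hom
      comm
        | .one => (IsMonHom.one_hom f.hom.hom).trans (Category.id_comp _).symm
        | .mul => IsMonHom.mul_hom f.hom.hom }

variable {A}

theorem UnitalMagma.isMonHom {M N : CommMon A}
    (f : (CommMon.toUnitalMagma A).obj M ⟶ (CommMon.toUnitalMagma A).obj N) :
    IsMonHom (M := M.X) (N := N.X) f.hom :=
  ⟨UnitalMagma.one_hom f, UnitalMagma.mul_hom f⟩

instance : (CommMon.toUnitalMagma A).Faithful where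
  map_injective h := CommMon.hom_ext _ _ (congrArg Dialgebra.Hom.hom h)

instance : (CommMon.toUnitalMagma A).Full where
  map_surjective {M N} f :=
    ⟨CommMon.homMk (Mon.Hom.mk (M := M.toMon) (N := N.toMon) f.hom
      (isMonHom_hom := UnitalMagma.isMonHom f)), rfl⟩

theorem CommMonEq.lhs_app_eq_rhs_app (e : CommMonEq) (M : CommMon A) :
    (e.lhs A).app ((CommMon.toUnitalMagma A).obj M) =
      (e.rhs A).app ((CommMon.toUnitalMagma A).obj M) := by
  cases e with
  | one_mul =>
    change (λ_ M.X).inv ≫ η[M.X] ▷ M.X ≫ μ[M.X] = 𝟙 M.X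
    rw [MonObj.one_mul, Iso.inv_hom_id]
  | mul_one =>
    change (ρ_ M.X).inv ≫ M.X ◁ η[M.X] ≫ μ[M.X] = 𝟙 M.X
    rw [MonObj.mul_one, Iso.inv_hom_id]
  | mul_assoc => exact MonObj.mul_assoc M.X
  | mul_comm => exact IsCommMonObj.mul_comm M.X

theorem CategoryTheory.CommMon.essImage_toUnitalMagma (X : UnitalMagma A)
    (hX : ∀ e : CommMonEq, (e.lhs A).app X = (e.rhs A).app X) :
    (CommMon.toUnitalMagma A).essImage X := by
  let : MonObj X.X :=
    { one := X.one
      mul := X.mul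
      -- The unit equations are encoded with inverse unitors, so that their source is the identity
      -- functor; here the unitor is moved to the other side.
      one_mul := (Iso.inv_comp_eq _).1 (hX .one_mul) |>.trans (Category.comp_id _)
      mul_one := (Iso.inv_comp_eq _).1 (hX .mul_one) |>.trans (Category.comp_id _)
      mul_assoc := hX .mul_assoc }
  have : IsCommMonObj X.X := ⟨hX .mul_comm⟩
  refine ⟨⟨X.X⟩, ⟨Dialgebra.isoMk (Iso.refl X.X) fun i => ?_⟩⟩
  cases i with
  | one => exact (Category.comp_id _).trans (Category.id_comp _).symm
  | mul => exact (Category.comp_id _).trans ((congrArg (· ≫ X.mul) (id_tensorHom_id _ _)).trans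
      (Category.id_comp _)).symm

end CommMonDialgebra

section CommMonPresentable

variable {A : Type u} [Category.{v} A] [MonoidalCategory A]
  (hleft : ∀ X : A, Functor.IsFinitelyAccessible.{v} (tensorLeft X))
  (hright : ∀ X : A, Functor.IsFinitelyAccessible.{v} (tensorRight X))

include hleft hright

theorem MonOp.isFinitelyAccessible_source (i : MonOp) :
    Functor.IsFinitelyAccessible.{v} (i.source A) := by
  cases i with
  | one => exact inferInstanceAs (((Functor.const A).obj (𝟙_ A)).IsCardinalAccessible _)
  | mul => exact isFinitelyAccessible_tensorFunctors hleft hright _ _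

theorem CommMonEq.isFinitelyAccessible_source (e : CommMonEq) :
    Functor.IsFinitelyAccessible.{v} (e.source A) := by
  have := isFinitelyAccessible_tensorFunctors hleft hright (𝟭 A) (𝟭 A)
  cases e with
  | one_mul => exact inferInstanceAs ((𝟭 A).IsCardinalAccessible _)
  | mul_one => exact inferInstanceAs ((𝟭 A).IsCardinalAccessible _)
  | mul_assoc => exact isFinitelyAccessible_tensorFunctors hleft hright _ _
  | mul_comm => exact isFinitelyAccessible_tensorFunctors hleft hright _ _

variable [IsLocallyPresentable.{v} A]

theorem exists_isAdaptedCardinal_commMon (κ₀ : Cardinal.{v}) :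
    ∃ (κ : Cardinal.{v}) (_ : Fact κ.IsRegular), κ₀ ≤ κ ∧
      IsAdaptedCardinal (MonOp.source A) (CommMonEq.source A) κ := by
  obtain ⟨κ, _, h₀, h₁, h₂, h₃, h₄⟩ := exists_isCardinalPresentable_tensor hleft hright κ₀
  refine ⟨κ, inferInstance, h₀, h₁, h₂, fun i X hX => ?_, fun e X hX => ?_⟩
  · cases i with
    | one => exact h₃
    | mul => exact h₄ X X hX hX
  · cases e with
    | one_mul => exact hX
    | mul_one => exact hX
    | mul_assoc => exact h₄ _ _ (h₄ X X hX hX) hX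
    | mul_comm => exact h₄ X X hX hX

variable [SymmetricCategory A]

/-- The category of commutative monoids is cocomplete. -/
theorem CategoryTheory.CommMon.hasColimitsOfSize : HasColimitsOfSize.{v, v} (CommMon A) := by
  have := IsLocallyPresentable.hasLimits A
  have : HasLimitsOfSize.{v, v} (CommMon A) := ⟨fun _ _ => inferInstance⟩
  have := MonOp.isFinitelyAccessible_source hleft hright
  have := CommMonEq.isFinitelyAccessible_source hleft hright
  exact hasColimitsOfSize_of_equations (CommMon.toUnitalMagma A) (CommMonEq.lhs A)
    (CommMonEq.rhs A) CommMonEq.lhs_app_eq_rhs_app CommMon.essImage_toUnitalMagma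
    (exists_isAdaptedCardinal_commMon hleft hright)

/-- The category of commutative monoids is locally presentable. -/
theorem CategoryTheory.CommMon.isLocallyPresentable : IsLocallyPresentable.{v} (CommMon A) := by
  have := CommMon.hasColimitsOfSize hleft hright
  have := MonOp.isFinitelyAccessible_source hleft hright
  have := CommMonEq.isFinitelyAccessible_source hleft hright
  exact isLocallyPresentable_of_equations (CommMon.toUnitalMagma A) (CommMonEq.lhs A)
    (CommMonEq.rhs A) CommMonEq.lhs_app_eq_rhs_app CommMon.essImage_toUnitalMagma
    (exists_isAdaptedCardinal_commMon hleft hright)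

end CommMonPresentable

/-! ### Pointwise products preserve limits -/

section CartesianTensor

variable {D : Type u} [Category.{v} D] [CartesianMonoidalCategory D] (F G : D ⥤ D)
  {J : Type*} [Category* J]

theorem comp_fst_eq_of_comp_tensorHom_eq {S X X' Y Y' : D} {a : S ⟶ X ⊗ Y} {b : S ⟶ X' ⊗ Y'}
    {f : X ⟶ X'} {g : Y ⟶ Y'} (h : a ≫ (f ⊗ₘ g) = b) :
    b ≫ CartesianMonoidalCategory.fst X' Y' = (a ≫ CartesianMonoidalCategory.fst X Y) ≫ f := by
  rw [← h, Category.assoc, CartesianMonoidalCategory.tensorHom_fst, Category.assoc]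

theorem comp_snd_eq_of_comp_tensorHom_eq {S X X' Y Y' : D} {a : S ⟶ X ⊗ Y} {b : S ⟶ X' ⊗ Y'}
    {f : X ⟶ X'} {g : Y ⟶ Y'} (h : a ≫ (f ⊗ₘ g) = b) :
    b ≫ CartesianMonoidalCategory.snd X' Y' = (a ≫ CartesianMonoidalCategory.snd X Y) ≫ g := by
  rw [← h, Category.assoc, CartesianMonoidalCategory.tensorHom_snd, Category.assoc]

/-- The components of a cone over a pointwise product. -/
def fstCone {K : J ⥤ D} (s : Cone (K ⋙ tensorFunctors F G)) : Cone (K ⋙ F) :=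
  Cone.mk s.pt
    { app j := s.π.app j ≫ CartesianMonoidalCategory.fst (F.obj (K.obj j)) (G.obj (K.obj j))
      naturality _ _ f :=
        (Category.id_comp _).trans (comp_fst_eq_of_comp_tensorHom_eq (s.w f)) }

/-- The components of a cone over a pointwise product. -/
def sndCone {K : J ⥤ D} (s : Cone (K ⋙ tensorFunctors F G)) : Cone (K ⋙ G) :=
  Cone.mk s.pt
    { app j := s.π.app j ≫ CartesianMonoidalCategory.snd (F.obj (K.obj j)) (G.obj (K.obj j))
      naturality _ _ f :=
        (Category.id_comp _).trans (comp_snd_eq_of_comp_tensorHom_eq (s.w f)) }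

/-- Limits commute with binary products. Dually, copowers preserve colimits, which makes the targets
of the cogroup operations finitary. -/
theorem preservesLimitsOfShape_tensorFunctors [PreservesLimitsOfShape J F]
    [PreservesLimitsOfShape J G] : PreservesLimitsOfShape J (tensorFunctors F G) where
  preservesLimit {K} :=
    { preserves {c} hc := by
        have hF := isLimitOfPreserves F hc
        have hG := isLimitOfPreserves G hc
        refine ⟨
          { lift s := CartesianMonoidalCategory.lift (hF.lift (fstCone F G s))
              (hG.lift (sndCone F G s))
            fac s j := ?_
            uniq s m hm := ?_ }⟩
        · refine (CartesianMonoidalCategory.lift_map _ _ _ _).trans ?_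
          apply CartesianMonoidalCategory.hom_ext
          · exact (CartesianMonoidalCategory.lift_fst _ _).trans (hF.fac (fstCone F G s) j)
          · exact (CartesianMonoidalCategory.lift_snd _ _).trans (hG.fac (sndCone F G s) j)
        · change s.pt ⟶ F.obj c.pt ⊗ G.obj c.pt at m
          have hm (j : J) : m ≫ (F.map (c.π.app j) ⊗ₘ G.map (c.π.app j)) = s.π.app j := hm j
          apply CartesianMonoidalCategory.hom_ext
          · refine Eq.trans ?_ (CartesianMonoidalCategory.lift_fst _ _).symm
            apply hF.hom_ext
            intro j
            exact (comp_fst_eq_of_comp_tensorHom_eq (hm j)).symm.trans (hF.fac (fstCone F G s) j).symm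
          · refine Eq.trans ?_ (CartesianMonoidalCategory.lift_snd _ _).symm
            apply hG.hom_ext
            intro j
            exact (comp_snd_eq_of_comp_tensorHom_eq (hm j)).symm.trans (hG.fac (sndCone F G s) j).symm }

theorem preservesLimitsOfSize_tensorFunctors [PreservesLimitsOfSize.{v, v} F]
    [PreservesLimitsOfSize.{v, v} G] : PreservesLimitsOfSize.{v, v} (tensorFunctors F G) where
  preservesLimitsOfShape := preservesLimitsOfShape_tensorFunctors F G

end CartesianTensor

/-! ### Cogroups as dialgebras with equations -/

/-- The operations of groups. -/
inductive GrpOp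
  | one
  | mul
  | inv

/-- The equations of groups. -/
inductive GrpEq
  | one_mul
  | mul_one
  | mul_assoc
  | left_inv
  | right_inv

instance : Finite GrpOp :=
  Finite.of_surjective (fun i : Fin 3 => if i = 0 then .one else if i = 1 then .mul else .inv)
    fun
    | .one => ⟨0, rfl⟩
    | .mul => ⟨1, rfl⟩
    | .inv => ⟨2, rfl⟩

instance : Finite GrpEq :=
  Finite.of_surjective (fun i : Fin 5 => if i = 0 then .one_mul else if i = 1 then .mul_one else
    if i = 2 then .mul_assoc else if i = 3 then .left_inv else .right_inv)
    fun
    | .one_mul => ⟨0, rfl⟩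
    | .mul_one => ⟨1, rfl⟩
    | .mul_assoc => ⟨2, rfl⟩
    | .left_inv => ⟨3, rfl⟩
    | .right_inv => ⟨4, rfl⟩

section CogroupDialgebra

variable (M : Type u) [Category.{v} M] [CartesianMonoidalCategory Mᵒᵖ]

/-- The targets of the cooperations of cogroups. -/
def GrpOp.target : GrpOp → M ⥤ M
  | one => (Functor.const M).obj (𝟙_ Mᵒᵖ).unop
  | mul => (tensorFunctors (𝟭 Mᵒᵖ) (𝟭 Mᵒᵖ)).unop
  | inv => 𝟭 M

/-- The targets of the equations of cogroups. -/
def GrpEq.target : GrpEq → M ⥤ M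
  | one_mul => 𝟭 M
  | mul_one => 𝟭 M
  | mul_assoc => (tensorFunctors (tensorFunctors (𝟭 Mᵒᵖ) (𝟭 Mᵒᵖ)) (𝟭 Mᵒᵖ)).unop
  | left_inv => 𝟭 M
  | right_inv => 𝟭 M

/-- Objects with a comultiplication, a counit and an antipode, without any axioms. -/
abbrev Precogroup : Type (max u v) := Dialgebra (fun _ => 𝟭 M) (GrpOp.target M)

variable {M}

namespace Precogroup

/-- The unital magma in the opposite category. -/
def toUnitalMagma (X : Precogroup M) : UnitalMagma Mᵒᵖ where
  X := op X.X
  str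
    | .one => (X.str .one).op
    | .mul => (X.str .mul).op

/-- The antipode, in the opposite category. -/
def inv (X : Precogroup M) : X.toUnitalMagma.X ⟶ X.toUnitalMagma.X := (X.str .inv).op

variable {X Y : Precogroup M} (f : X ⟶ Y)

/-- The morphism of unital magmas in the opposite category. -/
def toUnitalMagmaHom : Y.toUnitalMagma ⟶ X.toUnitalMagma where
  hom := f.hom.op
  comm
    | .one => congrArg Quiver.Hom.op (f.comm .one).symm
    | .mul => congrArg Quiver.Hom.op (f.comm .mul).symm

theorem inv_hom : Y.inv ≫ (toUnitalMagmaHom f).hom = (toUnitalMagmaHom f).hom ≫ X.inv :=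
  congrArg Quiver.Hom.op (f.comm .inv).symm

end Precogroup

namespace UnitalMagma

open CartesianMonoidalCategory

variable {D : Type u} [Category.{v} D] [CartesianMonoidalCategory D] {X Y : UnitalMagma D}
  (f : X ⟶ Y)

theorem toUnit_one_naturality :
    f.hom ≫ toUnit Y.X ≫ Y.one = (toUnit X.X ≫ X.one) ≫ f.hom := by
  rw [Category.assoc, one_hom, ← Category.assoc, toUnit_unique (f.hom ≫ toUnit Y.X) (toUnit X.X)]

theorem lift_mul_naturality {a b : X.X ⟶ X.X} {a' b' : Y.X ⟶ Y.X} (ha : a ≫ f.hom = f.hom ≫ a')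
    (hb : b ≫ f.hom = f.hom ≫ b') :
    f.hom ≫ lift a' b' ≫ Y.mul = (lift a b ≫ X.mul) ≫ f.hom := by
  rw [Category.assoc, mul_hom, ← Category.assoc, ← Category.assoc, comp_lift, lift_map, ha, hb]

end UnitalMagma

variable (M)

open CartesianMonoidalCategory in
/-- The left-hand sides of the equations of cogroups. -/
def GrpEq.lhs : ∀ e : GrpEq,
    Dialgebra.forget (fun _ => 𝟭 M) (GrpOp.target M) ⋙ 𝟭 M ⟶
      Dialgebra.forget (fun _ => 𝟭 M) (GrpOp.target M) ⋙ e.target M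
  | one_mul =>
    { app X := ((λ_ (op X.X)).inv ≫ (Precogroup.toUnitalMagma X).one ▷ op X.X ≫
        (Precogroup.toUnitalMagma X).mul).unop
      naturality _ _ f := Quiver.Hom.op_inj
        (UnitalMagma.one_mul_naturality (Precogroup.toUnitalMagmaHom f)).symm }
  | mul_one =>
    { app X := ((ρ_ (op X.X)).inv ≫ op X.X ◁ (Precogroup.toUnitalMagma X).one ≫
        (Precogroup.toUnitalMagma X).mul).unop
      naturality _ _ f := Quiver.Hom.op_inj
        (UnitalMagma.mul_one_naturality (Precogroup.toUnitalMagmaHom f)).symm }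
  | mul_assoc =>
    { app X := ((Precogroup.toUnitalMagma X).mul ▷ op X.X ≫
        (Precogroup.toUnitalMagma X).mul).unop
      naturality _ _ f := Quiver.Hom.op_inj
        (UnitalMagma.mul_mul_left_naturality (Precogroup.toUnitalMagmaHom f)).symm }
  | left_inv =>
    { app X := (lift (Precogroup.inv X) (𝟙 (op X.X)) ≫ (Precogroup.toUnitalMagma X).mul).unop
      naturality _ _ f := Quiver.Hom.op_inj
        (UnitalMagma.lift_mul_naturality (Precogroup.toUnitalMagmaHom f) (Precogroup.inv_hom f)
          ((Category.id_comp _).trans (Category.comp_id _).symm)).symm }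
  | right_inv =>
    { app X := (lift (𝟙 (op X.X)) (Precogroup.inv X) ≫ (Precogroup.toUnitalMagma X).mul).unop
      naturality _ _ f := Quiver.Hom.op_inj
        (UnitalMagma.lift_mul_naturality (Precogroup.toUnitalMagmaHom f)
          ((Category.id_comp _).trans (Category.comp_id _).symm) (Precogroup.inv_hom f)).symm }

open CartesianMonoidalCategory in
/-- The right-hand sides of the equations of cogroups. -/
def GrpEq.rhs : ∀ e : GrpEq,
    Dialgebra.forget (fun _ => 𝟭 M) (GrpOp.target M) ⋙ 𝟭 M ⟶
      Dialgebra.forget (fun _ => 𝟭 M) (GrpOp.target M) ⋙ e.target M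
  | one_mul => 𝟙 _
  | mul_one => 𝟙 _
  | mul_assoc =>
    { app X := ((α_ (op X.X) (op X.X) (op X.X)).hom ≫ op X.X ◁ (Precogroup.toUnitalMagma X).mul ≫
        (Precogroup.toUnitalMagma X).mul).unop
      naturality _ _ f := Quiver.Hom.op_inj
        (UnitalMagma.mul_mul_right_naturality (Precogroup.toUnitalMagmaHom f)).symm }
  | left_inv =>
    { app X := (toUnit (op X.X) ≫ (Precogroup.toUnitalMagma X).one).unop
      naturality _ _ f := Quiver.Hom.op_inj
        (UnitalMagma.toUnit_one_naturality (Precogroup.toUnitalMagmaHom f)).symm }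
  | right_inv =>
    { app X := (toUnit (op X.X) ≫ (Precogroup.toUnitalMagma X).one).unop
      naturality _ _ f := Quiver.Hom.op_inj
        (UnitalMagma.toUnit_one_naturality (Precogroup.toUnitalMagmaHom f)).symm }

/-- The underlying precogroup of a cogroup. -/
def cogroupToPrecogroup : (Grp Mᵒᵖ)ᵒᵖ ⥤ Precogroup M where
  obj X :=
    { X := X.unop.X.unop
      str
        | .one => η[X.unop.X].unop
        | .mul => μ[X.unop.X].unop
        | .inv => ι[X.unop.X].unop }
  map f :=
    { hom := f.unop.hom.hom.unop
      comm
        | .one => (Category.comp_id _).trans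
            (congrArg Quiver.Hom.unop (IsMonHom.one_hom f.unop.hom.hom)).symm
        | .mul => congrArg Quiver.Hom.unop (IsMonHom.mul_hom f.unop.hom.hom).symm
        | .inv => congrArg Quiver.Hom.unop (GrpObj.inv_hom f.unop.hom.hom).symm }

variable {M}

instance : (cogroupToPrecogroup M).Faithful where
  map_injective h := Quiver.Hom.unop_inj (Grp.hom_ext _ _
    (Quiver.Hom.unop_inj (congrArg Dialgebra.Hom.hom h)))

theorem Precogroup.isMonHom {X Y : (Grp Mᵒᵖ)ᵒᵖ}
    (f : (cogroupToPrecogroup M).obj X ⟶ (cogroupToPrecogroup M).obj Y) :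
    IsMonHom (M := Y.unop.X) (N := X.unop.X) f.hom.op :=
  ⟨UnitalMagma.one_hom (Precogroup.toUnitalMagmaHom f),
    UnitalMagma.mul_hom (Precogroup.toUnitalMagmaHom f)⟩

instance : (cogroupToPrecogroup M).Full where
  map_surjective {X Y} f :=
    ⟨(have := Precogroup.isMonHom f; Grp.homMk (A := Y.unop) (B := X.unop) f.hom.op).op, rfl⟩

theorem GrpEq.lhs_app_eq_rhs_app (e : GrpEq) (X : (Grp Mᵒᵖ)ᵒᵖ) :
    (e.lhs M).app ((cogroupToPrecogroup M).obj X) =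
      (e.rhs M).app ((cogroupToPrecogroup M).obj X) := by
  apply Quiver.Hom.op_inj
  cases e with
  | one_mul =>
    change (λ_ X.unop.X).inv ≫ η[X.unop.X] ▷ X.unop.X ≫ μ[X.unop.X] = 𝟙 X.unop.X
    rw [MonObj.one_mul, Iso.inv_hom_id]
  | mul_one =>
    change (ρ_ X.unop.X).inv ≫ X.unop.X ◁ η[X.unop.X] ≫ μ[X.unop.X] = 𝟙 X.unop.X
    rw [MonObj.mul_one, Iso.inv_hom_id]
  | mul_assoc => exact MonObj.mul_assoc X.unop.X
  | left_inv => exact GrpObj.left_inv X.unop.X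
  | right_inv => exact GrpObj.right_inv X.unop.X

theorem essImage_cogroupToPrecogroup (X : Precogroup M)
    (hX : ∀ e : GrpEq, (e.lhs M).app X = (e.rhs M).app X) :
    (cogroupToPrecogroup M).essImage X := by
  let : GrpObj (op X.X) :=
    { one := X.toUnitalMagma.one
      mul := X.toUnitalMagma.mul
      one_mul := (Iso.inv_comp_eq _).1 (congrArg Quiver.Hom.op (hX .one_mul)) |>.trans
        (Category.comp_id _)
      mul_one := (Iso.inv_comp_eq _).1 (congrArg Quiver.Hom.op (hX .mul_one)) |>.trans
        (Category.comp_id _)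
      mul_assoc := congrArg Quiver.Hom.op (hX .mul_assoc)
      inv := X.inv
      left_inv := congrArg Quiver.Hom.op (hX .left_inv)
      right_inv := congrArg Quiver.Hom.op (hX .right_inv) }
  refine ⟨op ⟨op X.X⟩, ⟨Dialgebra.isoMk (Iso.refl X.X) fun i => ?_⟩⟩
  refine Eq.trans ?_ (Category.id_comp _).symm
  cases i with
  | one => exact Category.comp_id _
  | mul =>
    exact Quiver.Hom.op_inj ((congrArg (· ≫ X.toUnitalMagma.mul) (id_tensorHom_id _ _)).trans
      (Category.id_comp _))
  | inv => exact Category.comp_id _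

theorem GrpOp.isFinitelyAccessible_target (i : GrpOp) :
    Functor.IsFinitelyAccessible.{v} (i.target M) := by
  have := preservesLimitsOfSize_tensorFunctors (𝟭 Mᵒᵖ) (𝟭 Mᵒᵖ)
  cases i with
  | one => exact inferInstanceAs (((Functor.const M).obj _).IsCardinalAccessible _)
  | mul =>
    have := preservesColimitsOfSize_unop.{v, v} (tensorFunctors (𝟭 Mᵒᵖ) (𝟭 Mᵒᵖ))
    exact inferInstanceAs ((tensorFunctors (𝟭 Mᵒᵖ) (𝟭 Mᵒᵖ)).unop.IsCardinalAccessible _)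
  | inv => exact inferInstanceAs ((𝟭 M).IsCardinalAccessible _)

theorem GrpEq.isFinitelyAccessible_target (e : GrpEq) :
    Functor.IsFinitelyAccessible.{v} (e.target M) := by
  have := preservesLimitsOfSize_tensorFunctors (𝟭 Mᵒᵖ) (𝟭 Mᵒᵖ)
  have := preservesLimitsOfSize_tensorFunctors (tensorFunctors (𝟭 Mᵒᵖ) (𝟭 Mᵒᵖ)) (𝟭 Mᵒᵖ)
  cases e with
  | mul_assoc =>
    have := preservesColimitsOfSize_unop.{v, v}
      (tensorFunctors (tensorFunctors (𝟭 Mᵒᵖ) (𝟭 Mᵒᵖ)) (𝟭 Mᵒᵖ))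
    exact inferInstanceAs
      ((tensorFunctors (tensorFunctors (𝟭 Mᵒᵖ) (𝟭 Mᵒᵖ)) (𝟭 Mᵒᵖ)).unop.IsCardinalAccessible _)
  | _ => exact inferInstanceAs ((𝟭 M).IsCardinalAccessible _)

/-- The category of cogroups in a locally presentable category is locally presentable. -/
theorem isLocallyPresentable_cogroup [IsLocallyPresentable.{v} M] :
    IsLocallyPresentable.{v} (Grp Mᵒᵖ)ᵒᵖ := by
  obtain ⟨κ, _, _⟩ := IsLocallyPresentable.exists_cardinal.{v} M
  -- Dually, cogroups are cocomplete, so no solution set argument is needed here.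
  have : HasLimitsOfSize.{v, v} (Grp Mᵒᵖ) := ⟨fun _ _ => inferInstance⟩
  have := GrpOp.isFinitelyAccessible_target (M := M)
  have := GrpEq.isFinitelyAccessible_target (M := M)
  refine isLocallyPresentable_of_equations (cogroupToPrecogroup M) (H := fun _ => 𝟭 M)
    (GrpEq.lhs M) (GrpEq.rhs M) GrpEq.lhs_app_eq_rhs_app essImage_cogroupToPrecogroup
    fun κ₀ => ?_
  -- All sources are identity functors, so every large enough uncountable regular cardinal is
  -- adapted; the bound on small subsets is discarded.
  obtain ⟨l, _, h₁, h₂, h₃, -⟩ := exists_boundsSmallSubsets κ κ₀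
  exact ⟨l, inferInstance, h₂.le, h₃, IsCardinalLocallyPresentable.of_le M h₁.le,
    fun _ _ hX => hX, fun _ _ hX => hX⟩

end CogroupDialgebra

/-! ### Protomodularity of internal groups -/

section Protomodular

variable {D : Type u} [Category.{v} D] [CartesianMonoidalCategory D]

/-- For a split epimorphism of internal groups, a morphism through which the section and the
projection of a pullback factor is a split epimorphism of the underlying objects. -/
theorem isSplitEpi_of_factors_section_of_factors_pullback {X Y B P W : D} [GrpObj X] [GrpObj Y]
    [GrpObj B] [GrpObj W] {r : X ⟶ Y} {s : Y ⟶ X} {f : B ⟶ Y} {k : P ⟶ X} {t : P ⟶ B}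
    [IsMonHom r] [IsMonHom f] (hsr : s ≫ r = 𝟙 Y) (h : IsPullback k t r f) (m : W ⟶ X)
    [IsMonHom m] (s' : Y ⟶ W) (k' : P ⟶ W) (hs : s' ≫ m = s) (hk : k' ≫ m = k) :
    IsSplitEpi m := by
  -- In generalized elements, `x · s(r x)⁻¹` lies over the unit of `Y`, which is the image under `f`
  -- of the unit of `B`, so it lifts to `P`.
  have hd : (𝟙 X / (r ≫ s)) ≫ r = (1 : X ⟶ B) ≫ f := by
    rw [GrpObj.div_comp, MonObj.one_comp, Category.assoc, hsr, Category.id_comp, Category.comp_id,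
      div_self']
  -- The product taken in `W` is sent by `m` to `(x · s(r x)⁻¹) · s(r x) = x`.
  refine ⟨⟨⟨(h.lift _ _ hd ≫ k') * (r ≫ s'), ?_⟩⟩⟩
  rw [MonObj.mul_comp, Category.assoc, Category.assoc, hk, hs, h.lift_fst, div_mul_cancel]

/-- The forgetful functor to `D` preserves pullbacks and monomorphisms and reflects isomorphisms, so
the splitting on underlying objects suffices even though it need not be a homomorphism. -/
theorem CategoryTheory.Grp.isProtomodular [HasPullbacks D] : IsProtomodular (Grp D) where
  hasPullback _ _ _ _ _ _ _ := inferInstance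
  jointlyExtremalEpic X Y B P r s f k t hsr h W m s' k' hm hs hk := by
    have h' := h.map (Grp.forget D)
    have : Mono ((Grp.forget D).map m) := inferInstance
    have : IsSplitEpi ((Grp.forget D).map m) := by
      have : IsMonHom (M := X.X) (N := Y.X) ((Grp.forget D).map r) := r.hom.isMonHom_hom
      have : IsMonHom (M := B.X) (N := Y.X) ((Grp.forget D).map f) := f.hom.isMonHom_hom
      have : IsMonHom (M := W.X) (N := X.X) ((Grp.forget D).map m) := m.hom.isMonHom_hom
      exact isSplitEpi_of_factors_section_of_factors_pullback (X := X.X) (Y := Y.X) (B := B.X)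
        (W := W.X) (s := (Grp.forget D).map s) (congrArg (Grp.forget D).map hsr) h'
        ((Grp.forget D).map m) ((Grp.forget D).map s') ((Grp.forget D).map k')
        (congrArg (Grp.forget D).map hs) (congrArg (Grp.forget D).map hk)
    have : IsIso ((Grp.forget D).map m) := isIso_of_mono_of_isSplitEpi _
    have : (Grp.forget D).ReflectsIsomorphisms :=
      inferInstanceAs ((Grp.forget₂Mon D ⋙ Mon.forget D).ReflectsIsomorphisms)
    exact isIso_of_reflects_iso m (Grp.forget D)

/-- Needed because the opposite of `CommHopf A` is literally a double opposite of a category of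
groups. -/
theorem IsProtomodular.opOp {C : Type u} [Category.{v} C] [HasPullbacks C]
    (hC : IsProtomodular C) : IsProtomodular Cᵒᵖᵒᵖ where
  hasPullback _ _ _ _ _ _ _ := inferInstance
  jointlyExtremalEpic X Y B P r s f k t hsr h W m s' k' hm hs hk := by
    have := hC.jointlyExtremalEpic r.unop.unop s.unop.unop f.unop.unop k.unop.unop t.unop.unop
      (congrArg (fun g => g.unop.unop) hsr) h.unop.unop m.unop.unop s'.unop.unop k'.unop.unop
      inferInstance (congrArg (fun g => g.unop.unop) hs) (congrArg (fun g => g.unop.unop) hk)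
    have := (isIso_unop_iff m.unop).1 this
    exact (isIso_unop_iff m).1 this

end Protomodular

theorem proposition3p1 (A : Type u) [Category.{v} A] [MonoidalCategory A] [SymmetricCategory A]
    (hA : IsLocallyPresentable.{v} A)
    (hleft : ∀ X : A, PreservesDirectedColimits (tensorLeft X))
    (hright : ∀ X : A, PreservesDirectedColimits (tensorRight X)) :
    IsLocallyPresentable.{v} (CommHopf A) ∧
      HasZeroObject (CommHopf A) ∧
      IsProtomodular (CommHopf A)ᵒᵖ := by
  have hleft' (X : A) := (hleft X).isFinitelyAccessible
  have hright' (X : A) := (hright X).isFinitelyAccessible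
  have := CommMon.isLocallyPresentable hleft' hright'
  have := CommMon.hasColimitsOfSize hleft' hright'
  -- These are pushouts of commutative monoids.
  have : HasPullbacks (CommMon A)ᵒᵖ := by
    have : HasColimitsOfSize.{0, 0} (CommMon A) := hasColimitsOfSizeShrink.{0, 0, v, v} _
    infer_instance
  exact ⟨isLocallyPresentable_cogroup, inferInstance, (Grp.isProtomodular).opOp⟩
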